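/- Let $(I,\preceq)$ be a finite partially ordered set without isolated points (every $i\in I$ is comparable with some $j\ne i$). Let $\mathcal A=\prod_{i,j\in I}\mathcal A_{ij}$ be a Vinberg algebra over $I$. That is, the $\mathcal A_{ij}$ are finite-dimensional real vector spaces with $\mathcal A_{ii}=\mathbb R$, with $n_{ij}=\dim\mathcal A_{ij}>0$ if $i\ne j$ are comparable, and with $\mathcal A_{ij}=\{0\}$ if $i,j$ are incomparable. There are bilinear products $\mathcal A_{ij}\times\mathcal A_{jk}\to\mathcal A_{ik}$, for which the elements of $\mathcal A_{ii}=\mathbb R$ act as scalars on both sides, and linear involutions $\mathcal A_{ij}\to\mathcal A_{ji}$, equal to the identity on $\mathcal A_{ii}$. These define $AB$, $A^*$ and $\operatorname{tr}A=\sum_i a_{ii}$ as for matrices. With $\mathcal T_l=\{A:\ a_{ij}=0\text{ unless }j\preceq i\}$, the following hold: $\operatorname{tr}(AA^*)>0$ for $A\ne0$; $(AB)^*=B^*A^*$; $\operatorname{tr}(AB)=\operatorname{tr}(BA)$; $\operatorname{tr}(A(BC))=\operatorname{tr}((AB)C)$; and, for $S,T,U\in\mathcal T_l$, $(ST)U=S(TU)$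 and $T(UU^*)=(TU)U^*$. Let $\mathcal H=\{A:A^*=A\}$, let $\mathcal T_l^+$ be the set of elements of $\mathcal T_l$ with positive diagonal entries, $\mathcal P=\{TT^*:T\in\mathcal T_l^+\}$ and $\mathcal P^*=\{T^*T:T\in\mathcal T_l^+\}$. For $\theta=T^*T\in\mathcal P^*$ put $\theta^{-1}=T^{-1}(T^{-1})^*\in\mathcal P$, where $T^{-1}$ is the inverse in $\mathcal T_l^+$. For $\chi=(\lambda_i)_{i\in I}\in\mathbb R^I$ and $X=TT^*\in\mathcal P$ with $T=(t_{ij})\in\mathcal T_l^+$, let $$\Delta_\chi(X)=\prod_{k\in I}\Big(\frac{\prod_{j\preceq k}t_{jj}^2}{\prod_{j\prec k}t_{jj}^2}\Big)^{\lambda_k}.$$ For a positive measure $\mu$ on $\mathcal H$ and $\theta\in\mathcal H$ let $L_\mu(\theta)=\int e^{-\operatorname{tr}(\theta Z)}\,\mu(dZ)\in[0,\infty]$. Let $\wp$ be the set of $i\in I$ that have no element strictly below and some element strictly above them. Let $\mathcal S$ be the set of separators, i.e. of the $j\in I$ for which there are distinct $i_1,i_2\prec j$. For $i\in\wp\cup\mathcal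 S$ let $\varepsilon^i$ be the set of maps $\psi:I\to\{0,1\}$ with $\psi(j)=0$ for all $j\not\succeq i$ and, if $i\in\wp$, also for all $j\in\mathcal S$. Let $n_j^\psi=\sum_{k\prec j}\psi(k)n_{jk}$, and let $\Xi(i)$ be the set of all $(\lambda_j)_{j\in I}$ for which there is $\psi\in\varepsilon^i$ such that $\lambda_j=0$ if $j\not\succeq i$, $\lambda_j=n_j^\psi/2$ if $j\succeq i$ and $\psi(j)=0$, and $\lambda_j>n_j^\psi/2$ if $j\succeq i$ and $\psi(j)=1$. Put $\Xi=\sum_{i\in\wp\cup\mathcal S}\Xi(i)$ (Minkowski sum). **Theorem.** Let $\chi=(\lambda_i)_{i\in I}\in\Xi$. There is a positive measure $R_\chi$ on $\mathcal H$, the Riesz measure, such that $L_{R_\chi}(\theta)=\Delta_\chi(\theta^{-1})$ for all $\theta\in\mathcal P^*$. Every such measure $R_\chi$ generates a natural exponential family, that is, it is not concentrated on an affine hyperplane of $\mathcal H$ and $\{\theta\in\mathcal H: L_{R_\chi}(\theta)<\infty\}$ has non-empty interior, if and only if $\lambda_i\ne0$ for all $i\in\wp\cup\mathcal S$. -/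

import Mathlib

open MeasureTheory

/-- Matrices `(a_{ij})` indexed by `I × I`, the `(i, j)` entry lying in the real vector space
`A i j`. -/
abbrev BlockMatrix {I : Type*} (A : I → I → Type*) := ∀ i j, A i j

/-- The linear data of a Vinberg algebra over a finite poset `I`: the entry spaces are `ℝ` on the
diagonal, non-zero for comparable distinct indices and zero otherwise; `star` is the involution
`a_{ij} ↦ a_{ij}^* ∈ A j i` of the entries (identity on the diagonal) and `mul` are the bilinear
maps `A i j × A j k → A i k`, for which diagonal entries act as scalars (so that the matrix with
all diagonal entries `1` is the unit). -/
structure VinbergData (I : Type*) [PartialOrder I] (A : I → I → Type*)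
    [∀ i j, NormedAddCommGroup (A i j)] [∀ i j, NormedSpace ℝ (A i j)] where
  /-- the identification `A i i = ℝ` -/
  diag : ∀ i, A i i ≃ₗ[ℝ] ℝ
  finrank_pos : ∀ i j, j < i → 0 < Module.finrank ℝ (A i j)
  subsingleton : ∀ i j, ¬ i ≤ j → ¬ j ≤ i → Subsingleton (A i j)
  star : ∀ i j, A i j →ₗ[ℝ] A j i
  star_star : ∀ i j (a : A i j), star j i (star i j a) = a
  star_diag : ∀ i (a : A i i), star i i a = a
  mul : ∀ i j k, A i j →ₗ[ℝ] A j k →ₗ[ℝ] A i k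
  diag_mul : ∀ i j (a : A i i) (b : A i j), mul i i j a b = diag i a • b
  mul_diag : ∀ i j (b : A i j) (a : A j j), mul i j j b a = diag j a • b

namespace VinbergData

variable {I : Type*} [PartialOrder I] {A : I → I → Type*}
  [∀ i j, NormedAddCommGroup (A i j)] [∀ i j, NormedSpace ℝ (A i j)] (V : VinbergData I A)

/-- The trace. -/
def tr [Fintype I] (X : BlockMatrix A) : ℝ := ∑ i, V.diag i (X i i)

/-- The product of the algebra. -/
def prod [Fintype I] (X Y : BlockMatrix A) : BlockMatrix A :=
  fun i j => ∑ k, V.mul i k j (X i k) (Y k j)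

/-- The involution `X ↦ X^*` of the algebra. -/
def adj (X : BlockMatrix A) : BlockMatrix A := fun i j => V.star j i (X j i)

/-- The lower triangular matrices. -/
def Tl (_V : VinbergData I A) : Set (BlockMatrix A) := {X | ∀ i j, ¬ j ≤ i → X i j = 0}

/-- The lower triangular matrices with positive diagonal. -/
def TlPos : Set (BlockMatrix A) := {X | X ∈ V.Tl ∧ ∀ i, 0 < V.diag i (X i i)}

open Classical in
/-- The unit matrix. -/
noncomputable def one : BlockMatrix A :=
  fun i j => if h : i = j then h ▸ (V.diag i).symm 1 else 0

/-- The real vector space of Hermitian matrices, `X^* = X`. -/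
def hermitian : Submodule ℝ (BlockMatrix A) where
  carrier := {X | V.adj X = X}
  add_mem' := by
    intro X Y hX hY
    funext i j
    have h1 := congrFun (congrFun hX i) j
    have h2 := congrFun (congrFun hY i) j
    simp only [adj, Pi.add_apply, map_add] at *
    rw [h1, h2]
  zero_mem' := by
    funext i j
    simp [adj]
  smul_mem' := by
    intro c X hX
    funext i j
    have h1 := congrFun (congrFun hX i) j
    simp only [adj, Pi.smul_apply, map_smul] at *
    rw [h1]

end VinbergData

/-- A Vinberg algebra. -/
structure VinbergAlgebra (I : Type*) [PartialOrder I] [Fintype I] (A : I → I → Type*)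
    [∀ i j, NormedAddCommGroup (A i j)] [∀ i j, NormedSpace ℝ (A i j)]
    extends VinbergData I A where
  tr_self_pos : ∀ X : BlockMatrix A, X ≠ 0 →
    0 < toVinbergData.tr (toVinbergData.prod X (toVinbergData.adj X))
  adj_prod : ∀ X Y : BlockMatrix A, toVinbergData.adj (toVinbergData.prod X Y) =
    toVinbergData.prod (toVinbergData.adj Y) (toVinbergData.adj X)
  tr_comm : ∀ X Y : BlockMatrix A,
    toVinbergData.tr (toVinbergData.prod X Y) = toVinbergData.tr (toVinbergData.prod Y X)
  tr_assoc : ∀ X Y Z : BlockMatrix A,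
    toVinbergData.tr (toVinbergData.prod X (toVinbergData.prod Y Z)) =
      toVinbergData.tr (toVinbergData.prod (toVinbergData.prod X Y) Z)
  tri_assoc : ∀ S ∈ toVinbergData.Tl, ∀ T ∈ toVinbergData.Tl, ∀ U ∈ toVinbergData.Tl,
    toVinbergData.prod (toVinbergData.prod S T) U =
      toVinbergData.prod S (toVinbergData.prod T U)
  tri_assoc_adj : ∀ T ∈ toVinbergData.Tl, ∀ U ∈ toVinbergData.Tl,
    toVinbergData.prod T (toVinbergData.prod U (toVinbergData.adj U)) =
      toVinbergData.prod (toVinbergData.prod T U) (toVinbergData.adj U)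

/-- The minimal elements that are not maximal: nothing below, something above. -/
def initialSet (I : Type*) [PartialOrder I] : Set I :=
  {i | (∃ j, i < j) ∧ ¬ ∃ j, j < i}

/-- `j` separates the distinct elements `i₁` and `i₂` if it is above both and distinct from both;
the separators are the elements that separate some pair. -/
def separatorSet (I : Type*) [PartialOrder I] : Set I :=
  {j | ∃ i₁ i₂, i₁ ≠ i₂ ∧ i₁ ≤ j ∧ i₂ ≤ j ∧ j ≠ i₁ ∧ j ≠ i₂}

/-- For `i` in `initialSet I ∪ separatorSet I`: the maps `ψ : I → {0, 1}` that vanish off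
`{j | i ≤ j}` and, if `i` is in `initialSet I`, also on the separators. -/
def epsSet {I : Type*} [PartialOrder I] (i : I) : Set (I → Fin 2) :=
  {ψ | (∀ j, ¬ i ≤ j → ψ j = 0) ∧ (i ∈ initialSet I → ∀ j ∈ separatorSet I, ψ j = 0)}

namespace VinbergAlgebra

variable {I : Type*} [PartialOrder I] [Fintype I] {A : I → I → Type*}
  [∀ i j, NormedAddCommGroup (A i j)] [∀ i j, NormedSpace ℝ (A i j)] (V : VinbergAlgebra I A)

/-- The dual cone `{T^* T | T ∈ T_l^+}`, under the identification of the space of Hermitian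
matrices with its dual by `(X, Y) ↦ tr (X Y)`. -/
def dualCone : Set (BlockMatrix A) := {X | ∃ T ∈ V.TlPos, X = V.prod (V.adj T) T}

/-- For `X` in the homogeneous cone `{T T^* | T ∈ T_l^+}`, the unique `T ∈ T_l^+` with
`X = T T^*`. -/
noncomputable def triFactor (X : BlockMatrix A) : BlockMatrix A :=
  Classical.epsilon fun T => T ∈ V.TlPos ∧ X = V.prod T (V.adj T)

/-- For `θ = T^* T` in the dual cone, `T ∈ T_l^+`, the inverse `θ⁻¹ = T⁻¹ (T⁻¹)^*`, which lies in
the cone; here `T⁻¹` is the inverse in the group `T_l^+`. -/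
noncomputable def dualInv (θ : BlockMatrix A) : BlockMatrix A :=
  Classical.epsilon fun X => ∃ T ∈ V.TlPos, ∃ S ∈ V.TlPos,
    θ = V.prod (V.adj T) T ∧ V.prod S T = V.one ∧ V.prod T S = V.one ∧ X = V.prod S (V.adj S)

open Classical in
/-- The strict principal minor of order `k` of `X = T T^*`: the product of the `t_{jj}^2` over
`j < k`. -/
noncomputable def strictMinor (k : I) (X : BlockMatrix A) : ℝ :=
  ∏ j : I with j < k, V.diag j (V.triFactor X j j) ^ 2

open Classical in
/-- The large principal minor of order `k` of `X = T T^*`: the product of the `t_{jj}^2` over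
`j ≤ k`. -/
noncomputable def largeMinor (k : I) (X : BlockMatrix A) : ℝ :=
  ∏ j : I with j ≤ k, V.diag j (V.triFactor X j j) ^ 2

/-- The generalized power function of the multiplier `χ = (λ_k)`. -/
noncomputable def genPower (χ : I → ℝ) (X : BlockMatrix A) : ℝ :=
  ∏ k, (V.largeMinor k X / V.strictMinor k X) ^ χ k

open Classical in
/-- `n_j = ∑_{k < j} ψ(k) dim A_{jk}`. -/
noncomputable def nPsi (_V : VinbergAlgebra I A) (ψ : I → Fin 2) (j : I) : ℝ :=
  ∑ k : I with k < j, ((ψ k : ℕ) : ℝ) * (Module.finrank ℝ (A j k) : ℝ)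

/-- The set `Ξ(i, ψ)`. -/
def XiPsi (i : I) (ψ : I → Fin 2) : Set (I → ℝ) :=
  {χ | (∀ j, ¬ i ≤ j → χ j = 0) ∧ (∀ j, i ≤ j → ψ j = 0 → χ j = V.nPsi ψ j / 2) ∧
    (∀ j, i ≤ j → ψ j = 1 → V.nPsi ψ j / 2 < χ j)}

/-- The set `Ξ(i)`, the union of the `Ξ(i, ψ)`. -/
def XiAt (i : I) : Set (I → ℝ) := ⋃ ψ ∈ epsSet i, V.XiPsi i ψ

/-- The set `Ξ`: the Minkowski sum of the sets `Ξ(i)`, `i ∈ initialSet I ∪ separatorSet I`. -/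
def Xi : Set (I → ℝ) :=
  {χ | ∃ c : I → (I → ℝ), (∀ i ∈ initialSet I ∪ separatorSet I, c i ∈ V.XiAt i) ∧
    (∀ i ∉ initialSet I ∪ separatorSet I, c i = 0) ∧ χ = ∑ i, c i}

variable [∀ i j, MeasurableSpace (A i j)]

/-- The Laplace transform `L_μ(θ) = ∫ exp (-tr (θ Z)) μ(dZ)`, with values in `[0, ∞]`, of a measure
on the space of Hermitian matrices. -/
noncomputable def laplace (μ : Measure V.hermitian) (θ : BlockMatrix A) : ENNReal :=
  ∫⁻ Z, ENNReal.ofReal (Real.exp (-V.tr (V.prod θ Z))) ∂μ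

/-- `R` is the Riesz measure of `χ`: its Laplace transform is finite on the dual cone, where it
equals `θ ↦ Δ_χ(θ⁻¹)`. -/
def IsRieszMeasure (χ : I → ℝ) (R : Measure V.hermitian) : Prop :=
  ∀ θ ∈ V.dualCone, V.laplace R θ = ENNReal.ofReal (V.genPower χ (V.dualInv θ))

/-- `μ` generates a natural exponential family: it is not concentrated on an affine hyperplane of
the space of Hermitian matrices, and the interior of its Laplace domain is not empty. -/
def GeneratesNEF (μ : Measure V.hermitian) : Prop :=
  (∀ (f : V.hermitian →ₗ[ℝ] ℝ) (c : ℝ), f ≠ 0 → μ {Z | f Z ≠ c} ≠ 0) ∧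
    (interior {θ : V.hermitian | V.laplace μ θ < ⊤}).Nonempty

end VinbergAlgebra

lemma Fintype.eq_at_of_sum_eq {I M : Type*} [Fintype I] [AddCommGroup M] {f g : I → M} (j : I)
    (h : ∑ k, f k = ∑ k, g k) (hne : ∀ k, k ≠ j → f k = g k) : f j = g j := by
  classical
  rw [← Finset.add_sum_erase _ _ (Finset.mem_univ j),
    ← Finset.add_sum_erase _ g (Finset.mem_univ j),
    Finset.sum_congr rfl fun k hk => hne k (Finset.ne_of_mem_erase hk)] at h
  exact add_right_cancel h

namespace VinbergData

variable {I : Type*} [PartialOrder I] {A : I → I → Type*}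
  [∀ i j, NormedAddCommGroup (A i j)] [∀ i j, NormedSpace ℝ (A i j)] (V : VinbergData I A)

lemma adj_adj (X : BlockMatrix A) : V.adj (V.adj X) = X := by
  funext i j
  simp [adj, V.star_star]

/-- The involution as a linear map. -/
def adjₗ : BlockMatrix A →ₗ[ℝ] BlockMatrix A where
  toFun := V.adj
  map_add' X Y := by funext i j; simp [adj]
  map_smul' c X := by funext i j; simp [adj]

lemma adj_add (X Y : BlockMatrix A) : V.adj (X + Y) = V.adj X + V.adj Y := V.adjₗ.map_add X Y

lemma mem_hermitian {X : BlockMatrix A} : X ∈ V.hermitian ↔ V.adj X = X := Iff.rfl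

/-- The space of lower triangular matrices. -/
def lowerTri : Submodule ℝ (BlockMatrix A) where
  carrier := V.Tl
  add_mem' hX hY i j h := by simp [hX i j h, hY i j h]
  zero_mem' i j _ := rfl
  smul_mem' c X hX i j h := by simp [hX i j h]

lemma one_apply_self (i : I) : V.one i i = (V.diag i).symm 1 := by simp [one]

lemma one_apply_ne {i j : I} (h : i ≠ j) : V.one i j = 0 := by simp [one, h]

lemma one_mem_TlPos : V.one ∈ V.TlPos := by
  refine ⟨fun i j h => V.one_apply_ne ?_, fun i => by simp [one_apply_self]⟩
  rintro rfl
  exact h le_rfl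

lemma adj_one : V.adj V.one = V.one := by
  funext i j
  unfold adj
  by_cases h : i = j
  · subst h; simp [V.star_diag]
  · rw [V.one_apply_ne h, V.one_apply_ne (Ne.symm h), map_zero]

lemma one_mem_hermitian : V.one ∈ V.hermitian := V.adj_one

/-- The squared length of an entry. -/
def entrySq (i j : I) (a : A i j) : ℝ := V.diag i (V.mul i j i a (V.star i j a))

lemma entrySq_diag (i : I) (a : A i i) : V.entrySq i i a = V.diag i a ^ 2 := by
  simp [entrySq, V.star_diag, V.diag_mul, pow_two]

open Classical in
/-- The matrix whose only non-zero entry is `a`, at `(i, j)`. -/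
noncomputable def elem (_V : VinbergData I A) (i j : I) (a : A i j) : BlockMatrix A :=
  Pi.single i (Pi.single j a)

lemma elem_apply_same (i j : I) (a : A i j) : V.elem i j a i j = a := by simp [elem]

lemma elem_apply_ne_left {i p : I} (h : p ≠ i) (j m : I) (a : A i j) : V.elem i j a p m = 0 := by
  simp [elem, h]

lemma elem_apply_ne_right {j m : I} (h : m ≠ j) (i p : I) (a : A i j) :
    V.elem i j a p m = 0 := by
  by_cases hp : p = i
  · subst hp; simp [elem, h]
  · exact V.elem_apply_ne_left hp _ _ _

lemma elem_mem_Tl {i j : I} (h : j ≤ i) (a : A i j) : V.elem i j a ∈ V.Tl := by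
  intro p m hpm
  by_cases hp : p = i
  · by_cases hm : m = j
    · subst hp hm; exact absurd h hpm
    · exact V.elem_apply_ne_right hm _ _ _
  · exact V.elem_apply_ne_left hp _ _ _

lemma adj_elem (i j : I) (a : A i j) : V.adj (V.elem i j a) = V.elem j i (V.star i j a) := by
  funext p m
  unfold adj
  by_cases hp : p = j
  · by_cases hm : m = i
    · subst hp hm; simp [elem_apply_same]
    · rw [V.elem_apply_ne_left hm, V.elem_apply_ne_right hm, map_zero]
  · rw [V.elem_apply_ne_right hp, V.elem_apply_ne_left hp, map_zero]

variable [Fintype I]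

/-- The product as a bilinear map. -/
def prodₗ : BlockMatrix A →ₗ[ℝ] BlockMatrix A →ₗ[ℝ] BlockMatrix A :=
  LinearMap.mk₂ ℝ V.prod
    (fun X Y Z => by funext i j; simp [prod, Finset.sum_add_distrib])
    (fun c X Y => by funext i j; simp [prod, Finset.smul_sum])
    (fun X Y Z => by funext i j; simp [prod, Finset.sum_add_distrib])
    (fun c X Y => by funext i j; simp [prod, Finset.smul_sum])

/-- The trace as a linear form. -/
def trₗ : BlockMatrix A →ₗ[ℝ] ℝ where
  toFun := V.tr
  map_add' X Y := by simp [tr, Finset.sum_add_distrib]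
  map_smul' c X := by simp [tr, Finset.mul_sum]

lemma prodₗ_apply (X Y : BlockMatrix A) : V.prodₗ X Y = V.prod X Y := rfl

lemma trₗ_apply (X : BlockMatrix A) : V.trₗ X = V.tr X := rfl

lemma add_prod (X Y Z : BlockMatrix A) : V.prod (X + Y) Z = V.prod X Z + V.prod Y Z :=
  V.prodₗ.map_add₂ X Y Z

lemma prod_add (X Y Z : BlockMatrix A) : V.prod X (Y + Z) = V.prod X Y + V.prod X Z :=
  (V.prodₗ X).map_add Y Z

lemma tr_add (X Y : BlockMatrix A) : V.tr (X + Y) = V.tr X + V.tr Y := V.trₗ.map_add X Y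

lemma one_prod (X : BlockMatrix A) : V.prod V.one X = X := by
  funext i j
  unfold prod
  rw [Finset.sum_eq_single i]
  · simp [one_apply_self, V.diag_mul]
  · intro k _ hk
    simp [V.one_apply_ne hk.symm]
  · simp

lemma prod_one (X : BlockMatrix A) : V.prod X V.one = X := by
  funext i j
  unfold prod
  rw [Finset.sum_eq_single j]
  · simp [one_apply_self, V.mul_diag]
  · intro k _ hk
    simp [V.one_apply_ne hk]
  · simp

lemma prod_mem_Tl {S T : BlockMatrix A} (hS : S ∈ V.Tl) (hT : T ∈ V.Tl) :
    V.prod S T ∈ V.Tl := by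
  intro i j hij
  unfold prod
  refine Finset.sum_eq_zero fun k _ => ?_
  by_cases hk : k ≤ i
  · rw [hT k j fun h => hij (h.trans hk), map_zero]
  · rw [hS i k hk, map_zero, LinearMap.zero_apply]

lemma diag_prod {S T : BlockMatrix A} (hS : S ∈ V.Tl) (hT : T ∈ V.Tl) (i : I) :
    V.diag i (V.prod S T i i) = V.diag i (S i i) * V.diag i (T i i) := by
  unfold prod
  rw [Finset.sum_eq_single i]
  · simp [V.diag_mul]
  · intro k _ hk
    by_cases h : k ≤ i
    · rw [hT k i fun h' => hk (le_antisymm h h'), map_zero]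
    · rw [hS i k h, map_zero, LinearMap.zero_apply]
  · simp

lemma elem_prod_elem (i j k : I) (a : A i j) (b : A j k) :
    V.prod (V.elem i j a) (V.elem j k b) = V.elem i k (V.mul i j k a b) := by
  funext p q
  unfold prod
  rw [Finset.sum_eq_single j]
  · by_cases hp : p = i
    · by_cases hq : q = k
      · subst hp hq; simp [elem_apply_same]
      · rw [V.elem_apply_ne_right hq, V.elem_apply_ne_right hq, map_zero]
    · rw [V.elem_apply_ne_left hp, V.elem_apply_ne_left hp, map_zero, LinearMap.zero_apply]
  · intro m _ hm
    rw [V.elem_apply_ne_right hm, map_zero, LinearMap.zero_apply]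
  · simp

lemma tr_elem (i : I) (a : A i i) : V.tr (V.elem i i a) = V.diag i a := by
  unfold tr
  rw [Finset.sum_eq_single i]
  · rw [elem_apply_same]
  · intro k _ hk
    rw [V.elem_apply_ne_left hk, map_zero]
  · simp

lemma tr_prod_adj (X : BlockMatrix A) :
    V.tr (V.prod X (V.adj X)) = ∑ i, ∑ j, V.entrySq i j (X i j) := by
  simp [tr, prod, adj, entrySq]

lemma eq_zero_of_prod_eq_zero {S T : BlockMatrix A} (hT : T ∈ V.TlPos)
    (h : V.prod S T = 0) : S = 0 := by
  suffices ∀ j i, S i j = 0 by funext i j; exact this j i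
  intro j
  induction j using (wellFounded_gt (α := I)).induction with
  | _ j ih =>
    intro i
    have h1 := congrFun (congrFun h i) j
    unfold prod at h1
    rw [Finset.sum_eq_single j, V.mul_diag] at h1
    · exact (smul_eq_zero.1 h1).resolve_left (hT.2 j).ne'
    · intro k _ hk
      by_cases hjk : j ≤ k
      · rw [ih k (lt_of_le_of_ne hjk hk.symm), map_zero, LinearMap.zero_apply]
      · rw [hT.1 k j hjk, map_zero]
    · simp

lemma eq_of_prod_adj_eq {S T : BlockMatrix A} (hS : S ∈ V.TlPos) (hT : T ∈ V.TlPos)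
    (h : V.prod S (V.adj S) = V.prod T (V.adj T)) : S = T := by
  suffices ∀ j i, S i j = T i j by funext i j; exact this j i
  intro j
  induction j using (wellFounded_lt (α := I)).induction with
  | _ j ih =>
    have key : ∀ i, V.diag j (S j j) • S i j = V.diag j (T j j) • T i j := by
      intro i
      have h1 := Fintype.eq_at_of_sum_eq j (congrFun (congrFun h i) j) fun k hk => by
        by_cases hkj : k ≤ j
        · simp only [adj, ih k (lt_of_le_of_ne hkj hk)]
        · simp only [adj, hS.1 j k hkj, hT.1 j k hkj, map_zero]
      simpa [adj, V.star_diag, V.mul_diag] using h1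
    have hd : V.diag j (S j j) = V.diag j (T j j) := by
      have h1 := congrArg (V.diag j) (key j)
      simp only [map_smul, smul_eq_mul] at h1
      nlinarith [hS.2 j, hT.2 j]
    intro i
    have h1 := key i
    rw [hd] at h1
    exact smul_right_injective _ (hT.2 j).ne' h1

lemma eq_of_adj_prod_eq {S T : BlockMatrix A} (hS : S ∈ V.TlPos) (hT : T ∈ V.TlPos)
    (h : V.prod (V.adj S) S = V.prod (V.adj T) T) : S = T := by
  suffices ∀ i j, S i j = T i j by funext i j; exact this i j
  intro i
  induction i using (wellFounded_gt (α := I)).induction with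
  | _ i ih =>
    have key : ∀ j, V.diag i (S i i) • S i j = V.diag i (T i i) • T i j := by
      intro j
      have h1 := Fintype.eq_at_of_sum_eq i (congrFun (congrFun h i) j) fun k hk => by
        by_cases hki : i ≤ k
        · simp only [adj, ih k (lt_of_le_of_ne hki hk.symm)]
        · simp only [adj, hS.1 k i hki, hT.1 k i hki, map_zero, LinearMap.zero_apply]
      simpa [adj, V.star_diag, V.diag_mul] using h1
    have hd : V.diag i (S i i) = V.diag i (T i i) := by
      have h1 := congrArg (V.diag i) (key i)
      simp only [map_smul, smul_eq_mul] at h1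
      nlinarith [hS.2 i, hT.2 i]
    intro j
    have h1 := key j
    rw [hd] at h1
    exact smul_right_injective _ (hT.2 i).ne' h1

end VinbergData

namespace VinbergAlgebra

variable {I : Type*} [PartialOrder I] [Fintype I] {A : I → I → Type*}
  [∀ i j, NormedAddCommGroup (A i j)] [∀ i j, NormedSpace ℝ (A i j)] (V : VinbergAlgebra I A)

lemma prod_adj_mem_hermitian (X : BlockMatrix A) : V.prod X (V.adj X) ∈ V.hermitian := by
  rw [V.mem_hermitian, V.adj_prod, V.adj_adj]

lemma adj_prod_mem_hermitian (X : BlockMatrix A) : V.prod (V.adj X) X ∈ V.hermitian := by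
  rw [V.mem_hermitian, V.adj_prod, V.adj_adj]

lemma entrySq_pos (i j : I) {a : A i j} (ha : a ≠ 0) : 0 < V.entrySq i j a := by
  have h := V.tr_self_pos (V.elem i j a) fun h => ha <| by
    rw [← V.elem_apply_same i j a, h]; rfl
  rwa [V.adj_elem, V.elem_prod_elem, V.tr_elem] at h

lemma mul_mul_star {j l k : I} (hlj : l ≤ j) (hkl : k ≤ l) (a : A j l) (v : A l k) :
    V.mul j k l (V.mul j l k a v) (V.star l k v) = V.entrySq l k v • a := by
  have h := V.tri_assoc_adj _ (V.elem_mem_Tl hlj a) _ (V.elem_mem_Tl hkl v)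
  rw [V.adj_elem, V.elem_prod_elem, V.elem_prod_elem, V.elem_prod_elem, V.elem_prod_elem] at h
  have h1 := congrFun (congrFun h j) l
  rw [V.elem_apply_same, V.elem_apply_same, V.mul_diag] at h1
  exact h1.symm

lemma tr_dual_prod {T U : BlockMatrix A} (hT : T ∈ V.Tl) (hU : U ∈ V.Tl) :
    V.tr (V.prod (V.prod (V.adj T) T) (V.prod U (V.adj U))) =
      V.tr (V.prod (V.prod T U) (V.adj (V.prod T U))) := by
  rw [← V.tr_assoc, V.tri_assoc_adj T hT U hU, V.tr_comm, ← V.tr_assoc, V.adj_prod]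

lemma genPower_prod_adj (χ : I → ℝ) {S : BlockMatrix A} (hS : S ∈ V.TlPos) :
    V.genPower χ (V.prod S (V.adj S)) = ∏ k, (V.diag k (S k k) ^ 2) ^ χ k := by
  classical
  have h1 : V.triFactor (V.prod S (V.adj S)) = S := by
    have h := Classical.epsilon_spec
      (p := fun T => T ∈ V.TlPos ∧ V.prod S (V.adj S) = V.prod T (V.adj T)) ⟨S, hS, rfl⟩
    exact (V.eq_of_prod_adj_eq hS h.1 h.2).symm
  unfold genPower
  refine Finset.prod_congr rfl fun k _ => ?_
  congr 1
  unfold largeMinor strictMinor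
  rw [h1, div_eq_iff]
  · have : (Finset.univ.filter fun j : I => j ≤ k) =
        insert k (Finset.univ.filter fun j : I => j < k) := by
      ext j; simp [le_iff_eq_or_lt]
    rw [this, Finset.prod_insert (by simp)]
  · exact Finset.prod_ne_zero_iff.2 fun j _ => pow_ne_zero 2 (hS.2 j).ne'

variable [∀ i j, FiniteDimensional ℝ (A i j)]

lemma exists_inverse {T : BlockMatrix A} (hT : T ∈ V.TlPos) :
    ∃ S ∈ V.TlPos, V.prod S T = V.one ∧ V.prod T S = V.one := by
  let f : V.lowerTri →ₗ[ℝ] V.lowerTri :=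
    ((V.prodₗ.flip T).comp V.lowerTri.subtype).codRestrict V.lowerTri
      fun S => V.prod_mem_Tl S.2 hT.1
  have hf : Function.Injective f := by
    rw [← LinearMap.ker_eq_bot, LinearMap.ker_eq_bot']
    intro S hS
    exact Subtype.ext (V.eq_zero_of_prod_eq_zero hT (congrArg Subtype.val hS))
  obtain ⟨⟨S, hS⟩, hST⟩ := LinearMap.surjective_of_injective hf ⟨V.one, V.one_mem_TlPos.1⟩
  replace hST : V.prod S T = V.one := congrArg Subtype.val hST
  refine ⟨S, ⟨hS, fun i => ?_⟩, hST, ?_⟩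
  · have h := V.diag_prod hS hT.1 i
    rw [hST, V.one_apply_self, LinearEquiv.apply_symm_apply] at h
    exact pos_of_mul_pos_left (h ▸ one_pos) (hT.2 i).le
  · have h1 : V.prod (V.prod T S) T = V.prod V.one T := by
      rw [V.tri_assoc T hT.1 S hS T hT.1, hST, V.prod_one, V.one_prod]
    have h2 := V.eq_zero_of_prod_eq_zero (S := V.prod T S - V.one) hT
      ((V.prodₗ.map_sub₂ _ _ _).trans (sub_eq_zero.2 h1))
    exact sub_eq_zero.1 h2

lemma genPower_dualInv (χ : I → ℝ) {T : BlockMatrix A} (hT : T ∈ V.TlPos) :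
    V.genPower χ (V.dualInv (V.prod (V.adj T) T)) = ∏ k, (V.diag k (T k k) ^ 2) ^ (-χ k) := by
  obtain ⟨S, hS, hST, hTS⟩ := V.exists_inverse hT
  obtain ⟨T', hT', S', hS', h, h1, -, h2⟩ := Classical.epsilon_spec
    (p := fun X => ∃ T' ∈ V.TlPos, ∃ S ∈ V.TlPos, V.prod (V.adj T) T = V.prod (V.adj T') T' ∧
      V.prod S T' = V.one ∧ V.prod T' S = V.one ∧ X = V.prod S (V.adj S))
    ⟨_, T, hT, S, hS, rfl, hST, hTS, rfl⟩
  change V.dualInv (V.prod (V.adj T) T) = _ at h2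
  obtain rfl := V.eq_of_adj_prod_eq hT hT' h
  rw [h2, V.genPower_prod_adj χ hS']
  refine Finset.prod_congr rfl fun k _ => ?_
  have h := V.diag_prod hS'.1 hT.1 k
  rw [h1, V.one_apply_self, LinearEquiv.apply_symm_apply] at h
  rw [eq_inv_of_mul_eq_one_left h.symm, inv_pow, Real.inv_rpow (sq_nonneg _),
    Real.rpow_neg (sq_nonneg _)]

end VinbergAlgebra

/-- The determinant of a block triangular endomorphism of a product with scalar diagonal blocks. -/
theorem LinearMap.det_pi_triangular {J : Type*} [Fintype J] [DecidableEq J] [PartialOrder J]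
    {M : J → Type*} [∀ j, AddCommGroup (M j)] [∀ j, Module ℝ (M j)] [∀ j, Module.Finite ℝ (M j)]
    (L : (∀ j, M j) →ₗ[ℝ] ∀ j, M j) (d : J → ℝ)
    (h : ∀ l (x : M l) j, ¬ l < j → L (Pi.single l x) j = d j • (Pi.single l x : ∀ j, M j) j) :
    LinearMap.det L = ∏ j, d j ^ Module.finrank ℝ (M j) := by
  classical
  let b := Pi.basis fun j => Module.finBasis ℝ (M j)
  let c : (Σ j, Fin (Module.finrank ℝ (M j))) → LinearExtension J :=
    fun p => toLinearExtension p.1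
  have hentry : ∀ p q, ¬ q.1 < p.1 →
      LinearMap.toMatrix b b L p q = if p = q then d p.1 else 0 := by
    intro p q hpq
    have h1 : b q = Pi.single q.1 (Module.finBasis ℝ (M q.1) q.2) := Pi.basis_apply _ q
    have h2 : L (b q) p.1 = d p.1 • (b q) p.1 := by rw [h1]; exact h _ _ _ hpq
    have h3 : ∀ v, b.repr v p = (Module.finBasis ℝ (M p.1)).repr (v p.1) p.2 :=
      fun v => Pi.basis_repr _ v p
    rw [LinearMap.toMatrix_apply, h3, h2, map_smul, Finsupp.smul_apply, ← h3, b.repr_self,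
      Finsupp.single_apply]
    simp [eq_comm]
  have hc : ∀ p q, c p ≤ c q → ¬ q.1 < p.1 := fun p q hpq hlt =>
    hlt.ne (le_antisymm (α := LinearExtension J) (toLinearExtension.monotone hlt.le) hpq)
  have htri : (LinearMap.toMatrix b b L).transpose.BlockTriangular c := by
    intro p q hpq
    rw [Matrix.transpose_apply, hentry q p (hc q p hpq.le), if_neg]
    rintro rfl
    exact lt_irrefl _ hpq
  have hblock : ∀ a, ((LinearMap.toMatrix b b L).transpose.toSquareBlock c a) =
      Matrix.diagonal fun p : {p // c p = a} => d p.1.1 := by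
    intro a
    ext p q
    rw [Matrix.toSquareBlock_def, Matrix.of_apply, Matrix.transpose_apply,
      hentry q.1 p.1 (hc _ _ (q.2.trans p.2.symm).le), Matrix.diagonal_apply]
    by_cases hpq : p = q
    · subst hpq; simp
    · rw [if_neg hpq, if_neg fun h => hpq (Subtype.ext h.symm)]
  rw [← LinearMap.det_toMatrix b, ← Matrix.det_transpose, htri.det]
  simp only [hblock, Matrix.det_diagonal]
  have h4 : ∀ a, ∏ p : {p // c p = a}, d p.1.1 =
      ∏ p ∈ Finset.univ.filter (fun p => c p = a), d p.1 :=
    fun a => (Finset.prod_subtype _ (by simp)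
      fun p : Σ j, Fin (Module.finrank ℝ (M j)) => d p.1).symm
  simp only [h4]
  rw [Finset.prod_fiberwise_of_maps_to (fun p _ => Finset.mem_image_of_mem c (Finset.mem_univ p)),
    Fintype.prod_sigma]
  simp

/-- The measure `r ^ (2 α - 1) dr` on the positive half-line. -/
noncomputable def radialMeasure (α : ℝ) : Measure ℝ :=
  (volume.restrict (Set.Ioi 0)).withDensity fun r => ENNReal.ofReal (r ^ (2 * α - 1))

instance (α : ℝ) : SFinite (radialMeasure α) := by unfold radialMeasure; infer_instance

lemma lintegral_radialMeasure {α t : ℝ} (hα : 0 < α) (ht : 0 < t) :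
    ∫⁻ r, ENNReal.ofReal (Real.exp (-(t ^ 2 * r ^ 2))) ∂radialMeasure α =
      ENNReal.ofReal ((t ^ 2) ^ (-α)) * ENNReal.ofReal (Real.Gamma α / 2) := by
  have hm : Measurable fun r : ℝ => ENNReal.ofReal (r ^ (2 * α - 1)) := by fun_prop
  rw [radialMeasure, lintegral_withDensity_eq_lintegral_mul _ hm (by fun_prop)]
  have h1 : ∀ r ∈ Set.Ioi (0 : ℝ), ((fun r : ℝ => ENNReal.ofReal (r ^ (2 * α - 1))) *
      fun r => ENNReal.ofReal (Real.exp (-(t ^ 2 * r ^ 2)))) r =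
      ENNReal.ofReal (r ^ (2 * α - 1) * Real.exp (-t ^ 2 * r ^ (2 : ℝ))) := by
    intro r hr
    have := Set.mem_Ioi.1 hr
    rw [Pi.mul_apply, ENNReal.ofReal_mul (by positivity)]
    norm_num
  rw [setLIntegral_congr_fun measurableSet_Ioi h1, ← ofReal_integral_eq_lintegral_ofReal,
    integral_rpow_mul_exp_neg_mul_rpow two_pos (by linarith) (by positivity),
    ← ENNReal.ofReal_mul (by positivity)]
  · congr 1
    rw [show -(2 * α - 1 + 1) / 2 = -α by ring, show (2 * α - 1 + 1) / 2 = α by ring]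
    ring
  · exact integrableOn_rpow_mul_exp_neg_mul_rpow (by linarith) (by norm_num) (by positivity)
  · filter_upwards [self_mem_ae_restrict measurableSet_Ioi] with r hr
    have := Set.mem_Ioi.1 hr
    positivity

lemma restrict_Ioi_absolutelyContinuous (α : ℝ) :
    (volume.restrict (Set.Ioi (0 : ℝ))) ≪ radialMeasure α := by
  refine withDensity_absolutelyContinuous' (by fun_prop) ?_
  filter_upwards [self_mem_ae_restrict measurableSet_Ioi] with r hr
  have := Real.rpow_pos_of_pos (Set.mem_Ioi.1 hr) (2 * α - 1)
  simpa using this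

section Gaussian

variable {E : Type*} [NormedAddCommGroup E] [NormedSpace ℝ E] [FiniteDimensional ℝ E]

lemma exists_mul_norm_sq_le {Q : E → ℝ} (hQ : Continuous Q)
    (hhom : ∀ (c : ℝ) x, Q (c • x) = c ^ 2 * Q x) (hpos : ∀ x, x ≠ 0 → 0 < Q x) :
    ∃ c > 0, ∀ x, c * ‖x‖ ^ 2 ≤ Q x := by
  have := FiniteDimensional.proper ℝ E
  have h0 : Q 0 = 0 := by simpa using hhom 0 0
  rcases (Metric.sphere (0 : E) 1).eq_empty_or_nonempty with he | hne
  · refine ⟨1, one_pos, fun x => ?_⟩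
    have : x = 0 := by
      by_contra hx
      have hmem : ‖x‖⁻¹ • x ∈ Metric.sphere (0 : E) 1 := by simp [norm_smul, hx]
      rw [he] at hmem
      exact hmem
    simp [this, h0]
  · obtain ⟨y, hy, hmin⟩ := (isCompact_sphere (0 : E) 1).exists_isMinOn hne hQ.continuousOn
    refine ⟨Q y, hpos y (by rintro rfl; simp at hy), fun x => ?_⟩
    by_cases hx : x = 0
    · simp [hx, h0]
    have hmem : ‖x‖⁻¹ • x ∈ Metric.sphere (0 : E) 1 := by simp [norm_smul, hx]
    have h1 : Q y ≤ Q (‖x‖⁻¹ • x) := hmin hmem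
    have hx' : 0 < ‖x‖ := norm_pos_iff.2 hx
    rw [hhom] at h1
    calc Q y * ‖x‖ ^ 2 ≤ ((‖x‖⁻¹) ^ 2 * Q x) * ‖x‖ ^ 2 := by gcongr
      _ = Q x := by field_simp

variable [MeasurableSpace E] [BorelSpace E] (μ : Measure E) [μ.IsAddHaarMeasure]

lemma lintegral_exp_neg_lt_top {Q : E → ℝ} (hQ : Continuous Q)
    (hhom : ∀ (c : ℝ) x, Q (c • x) = c ^ 2 * Q x) (hpos : ∀ x, x ≠ 0 → 0 < Q x) :
    ∫⁻ x, ENNReal.ofReal (Real.exp (-Q x)) ∂μ < ⊤ := by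
  obtain ⟨c, hc, hle⟩ := exists_mul_norm_sq_le hQ hhom hpos
  set n : ℕ := Module.finrank ℝ E + 1
  have hn : (0 : ℝ) < n := by positivity
  have hint := (integrable_one_add_norm (μ := μ) (E := E) (r := n) (by simp [n])).const_mul
    ((2 + n / c) ^ n)
  refine lt_of_le_of_lt (lintegral_mono fun x => ENNReal.ofReal_le_ofReal ?_)
    hint.lintegral_lt_top
  have hx := norm_nonneg x
  have h1 : 1 + ‖x‖ ≤ (2 + n / c) * (c / n * ‖x‖ ^ 2 + 1) := by
    have h2 : (2 + n / c) * (c / n * ‖x‖ ^ 2 + 1) =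
        2 * (c / n * ‖x‖ ^ 2) + ‖x‖ ^ 2 + 2 + n / c := by field_simp; ring
    rw [h2]
    have : 0 ≤ 2 * (c / n * ‖x‖ ^ 2) := by positivity
    have : 0 ≤ n / c := by positivity
    nlinarith [sq_nonneg (‖x‖ - 1)]
  have h2 : (1 + ‖x‖) ^ n ≤ (2 + n / c) ^ n * Real.exp (c * ‖x‖ ^ 2) := by
    have h3 : Real.exp (c * ‖x‖ ^ 2) = Real.exp (c / n * ‖x‖ ^ 2) ^ n := by
      rw [← Real.exp_nat_mul]; congr 1; field_simp
    rw [h3, ← mul_pow]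
    gcongr
    exact h1.trans (by gcongr; exact Real.add_one_le_exp _)
  rw [Real.rpow_neg (by positivity), Real.rpow_natCast, ← div_eq_mul_inv,
    le_div_iff₀ (by positivity)]
  calc Real.exp (-Q x) * (1 + ‖x‖) ^ n
      ≤ Real.exp (-(c * ‖x‖ ^ 2)) * ((2 + n / c) ^ n * Real.exp (c * ‖x‖ ^ 2)) := by
        gcongr
        exact hle x
    _ = (2 + n / c) ^ n := by rw [Real.exp_neg]; field_simp

lemma lintegral_comp_add_linearMap (f : E → ENNReal) (hf : Measurable f) (x : E) (L : E →ₗ[ℝ] E)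
    (hL : LinearMap.det L ≠ 0) :
    ∫⁻ v, f (x + L v) ∂μ = ENNReal.ofReal |(LinearMap.det L)⁻¹| * ∫⁻ v, f v ∂μ := by
  have hLm : Measurable L := (LinearMap.continuous_of_finiteDimensional L).measurable
  have h := lintegral_map (μ := μ) (f := fun w => f (x + w)) (by fun_prop) hLm
  rw [← h, Measure.map_linearMap_addHaar_eq_smul_addHaar μ hL, lintegral_smul_measure,
    lintegral_add_left_eq_self]
  rfl

lemma lintegral_radial_prod {Q : E → ℝ} (hQ : Continuous Q) {α t : ℝ} (hα : 0 < α) (ht : 0 < t)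
    (x : E) (L : E →ₗ[ℝ] E) (hL : LinearMap.det L ≠ 0) :
    ∫⁻ p, ENNReal.ofReal (Real.exp (-(t ^ 2 * p.1 ^ 2 + Q (p.1 • x + L p.2))))
        ∂(radialMeasure α).prod μ =
      ENNReal.ofReal ((t ^ 2) ^ (-α)) * ENNReal.ofReal |(LinearMap.det L)⁻¹| *
        (ENNReal.ofReal (Real.Gamma α / 2) * ∫⁻ v, ENNReal.ofReal (Real.exp (-Q v)) ∂μ) := by
  have hLc : Continuous L := LinearMap.continuous_of_finiteDimensional L
  have : SecondCountableTopology E := by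
    have := FiniteDimensional.proper ℝ E
    infer_instance
  have hc : Continuous fun p : ℝ × E =>
      Real.exp (-(t ^ 2 * p.1 ^ 2 + Q (p.1 • x + L p.2))) := by fun_prop
  rw [lintegral_prod _ hc.measurable.ennreal_ofReal.aemeasurable]
  have h1 : ∀ r : ℝ, ∫⁻ v, ENNReal.ofReal (Real.exp (-(t ^ 2 * r ^ 2 + Q (r • x + L v)))) ∂μ =
      ENNReal.ofReal (Real.exp (-(t ^ 2 * r ^ 2))) * (ENNReal.ofReal |(LinearMap.det L)⁻¹| *
        ∫⁻ v, ENNReal.ofReal (Real.exp (-Q v)) ∂μ) := by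
    intro r
    rw [← lintegral_comp_add_linearMap μ (fun v => ENNReal.ofReal (Real.exp (-Q v)))
      (by fun_prop) (r • x) L hL, ← lintegral_const_mul _ (by fun_prop)]
    refine lintegral_congr fun v => ?_
    rw [← ENNReal.ofReal_mul (Real.exp_pos _).le, ← Real.exp_add]
    congr 2
    ring
  simp only [h1]
  rw [lintegral_mul_const _ (by fun_prop), lintegral_radialMeasure hα ht]
  ring

end Gaussian

@[to_additive]
lemma Fintype.prod_eq_mul_prod_Ioi {I M : Type*} [Fintype I] [PartialOrder I] [CommMonoid M]
    (k : I) [Fintype {j // k < j}] (g : I → M) (hg : ∀ i, ¬ k ≤ i → g i = 1) :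
    ∏ i, g i = g k * ∏ j : {j // k < j}, g j := by
  classical
  rw [← Finset.mul_prod_erase _ g (Finset.mem_univ k),
    ← Finset.prod_subtype (Finset.univ.filter fun j => k < j) (by simp) g]
  congr 1
  symm
  refine Finset.prod_subset (fun j hj => ?_) fun j hj hj' => hg j fun h => hj' ?_
  · simp only [Finset.mem_filter, Finset.mem_univ, true_and] at hj
    simp [hj.ne']
  · simpa using lt_of_le_of_ne h (Finset.ne_of_mem_erase hj).symm

lemma BlockMatrix.column_ext {I : Type*} [PartialOrder I] {A : I → I → Type*}
    [∀ i j, Zero (A i j)] (k : I) {X Y : BlockMatrix A} (h0 : X k k = Y k k)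
    (h1 : ∀ j, k < j → X j k = Y j k)
    (hX : ∀ i l, ¬ (l = k ∧ k ≤ i) → X i l = 0) (hY : ∀ i l, ¬ (l = k ∧ k ≤ i) → Y i l = 0) :
    X = Y := by
  funext i l
  by_cases h : l = k ∧ k ≤ i
  · obtain ⟨rfl, h⟩ := h
    rcases h.eq_or_lt with rfl | h
    · exact h0
    · exact h1 i h
  · rw [hX i l h, hY i l h]

namespace VinbergData

variable {I : Type*} [PartialOrder I] {A : I → I → Type*}
  [∀ i j, NormedAddCommGroup (A i j)] [∀ i j, NormedSpace ℝ (A i j)] (V : VinbergData I A)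

open Classical in
/-- The matrix whose only non-zero column is the `k`-th, with diagonal entry `p.1` and entries
`p.2` below it. -/
noncomputable def column (k : I) : (ℝ × ∀ j : {j // k < j}, A j k) →ₗ[ℝ] BlockMatrix A where
  toFun p i := Pi.single k
    (if h : i = k then h ▸ (V.diag k).symm p.1 else if h : k < i then p.2 ⟨i, h⟩ else 0)
  map_add' p q := by
    funext i
    rw [Pi.add_apply, ← Pi.single_add]
    congr 1
    split_ifs with h
    · subst h; simp
    · rfl
    · simp
  map_smul' c p := by
    funext i
    rw [Pi.smul_apply, RingHom.id_apply, ← Pi.single_smul]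
    congr 1
    split_ifs with h
    · subst h; exact map_smul (V.diag i).symm c p.1
    · rfl
    · simp

variable (k : I) (p : ℝ × ∀ j : {j // k < j}, A j k)

lemma column_apply_self : V.column k p k k = (V.diag k).symm p.1 := by simp [column]

lemma column_apply_of_lt (j : {j // k < j}) : V.column k p j k = p.2 j := by
  simp [column, j.2.ne', j.2]

lemma column_apply_ne {l : I} (h : l ≠ k) (i : I) : V.column k p i l = 0 := by
  simp [column, h]

lemma column_apply_not_le {i : I} (h : ¬ k ≤ i) (l : I) : V.column k p i l = 0 := by
  by_cases hl : l = k
  · subst hl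
    have h1 : i ≠ l := fun h' => h h'.ge
    have h2 : ¬ l < i := fun h' => h h'.le
    simp [column, h1, h2]
  · exact V.column_apply_ne k p hl i

lemma column_mem_Tl : V.column k p ∈ V.Tl := by
  intro i l h
  by_cases hl : l = k
  · subst hl; exact V.column_apply_not_le l p h l
  · exact V.column_apply_ne k p hl i

variable [Fintype I]

open Classical in
/-- Left multiplication by `T` on the entries below the diagonal of the `k`-th column. -/
noncomputable def belowMul (T : BlockMatrix A) :
    (∀ j : {j // k < j}, A j k) →ₗ[ℝ] ∀ j : {j // k < j}, A j k :=
  LinearMap.pi fun j => ∑ l : {l // k < l}, (V.mul j l k (T j l)).comp (LinearMap.proj l)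

open Classical in
lemma belowMul_apply (T : BlockMatrix A) (v : ∀ j : {j // k < j}, A j k) (j : {j // k < j}) :
    V.belowMul k T v j = ∑ l : {l // k < l}, V.mul j l k (T j l) (v l) := by
  simp [belowMul]

lemma prod_column {T : BlockMatrix A} (hT : T ∈ V.Tl) :
    V.prod T (V.column k p) = V.column k
      (V.diag k (T k k) * p.1, p.1 • (fun j : {j // k < j} => T j k) + V.belowMul k T p.2) := by
  classical
  refine BlockMatrix.column_ext k ?_ (fun j hj => ?_) (fun i l h => ?_) fun i l h => ?_
  · unfold prod
    rw [Finset.sum_eq_single k, column_apply_self, column_apply_self, V.diag_mul]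
    · apply (V.diag k).injective; simp
    · intro l _ hl
      by_cases h : k ≤ l
      · rw [hT k l fun h' => hl (le_antisymm h' h), map_zero, LinearMap.zero_apply]
      · rw [V.column_apply_not_le k p h, map_zero]
    · simp
  · rw [V.column_apply_of_lt k _ ⟨j, hj⟩]
    unfold prod
    rw [Fintype.sum_eq_add_sum_Ioi k, column_apply_self, V.mul_diag]
    · dsimp only
      rw [Pi.add_apply, belowMul_apply]
      simp [column_apply_of_lt]
    · intro i hi
      rw [V.column_apply_not_le k p hi, map_zero]
  · by_cases hl : l = k
    · subst hl
      exact V.prod_mem_Tl hT (V.column_mem_Tl l p) i l fun h' => h ⟨rfl, h'⟩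
    · unfold prod
      exact Finset.sum_eq_zero fun m _ => by rw [V.column_apply_ne k p hl, map_zero]
  · by_cases hl : l = k
    · exact V.column_apply_not_le k _ (fun h' => h ⟨hl, h'⟩) l
    · exact V.column_apply_ne k _ hl i

open Classical in
/-- The squared length of a vector of entries below the diagonal of the `k`-th column. -/
noncomputable def belowSq (v : ∀ j : {j // k < j}, A j k) : ℝ :=
  ∑ j : {j // k < j}, V.entrySq j k (v j)

lemma tr_column_prod_adj :
    V.tr (V.prod (V.column k p) (V.adj (V.column k p))) = p.1 ^ 2 + V.belowSq k p.2 := by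
  classical
  have h0 : ∀ i j, V.entrySq i j 0 = 0 := fun i j => by simp [entrySq]
  have h1 : ∀ i, ∑ j, V.entrySq i j (V.column k p i j) = V.entrySq i k (V.column k p i k) :=
    fun i => Finset.sum_eq_single k
      (fun l _ hl => by rw [V.column_apply_ne k p hl, h0]) (by simp)
  rw [tr_prod_adj]
  simp only [h1]
  rw [Fintype.sum_eq_add_sum_Ioi k, column_apply_self, entrySq_diag,
    LinearEquiv.apply_symm_apply, belowSq]
  · simp only [column_apply_of_lt]
  · intro i hi
    rw [V.column_apply_not_le k p hi, h0]

open Classical in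
lemma det_belowMul [∀ i j, FiniteDimensional ℝ (A i j)] {T : BlockMatrix A} (hT : T ∈ V.Tl) :
    LinearMap.det (V.belowMul k T) =
      ∏ j : {j // k < j}, V.diag j (T j j) ^ Module.finrank ℝ (A j k) := by
  refine LinearMap.det_pi_triangular _ (fun j : {j // k < j} => V.diag j (T j j)) ?_
  intro l x j hlj
  rw [belowMul_apply, Finset.sum_eq_single l]
  · by_cases h : j = l
    · subst h; simp [V.diag_mul]
    · rw [hT j l fun h' => hlj (lt_of_le_of_ne h' (Ne.symm h)), map_zero, LinearMap.zero_apply,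
        Pi.single_eq_of_ne h, smul_zero]
  · intro m _ hm
    rw [Pi.single_eq_of_ne hm, map_zero]
  · simp

end VinbergData

namespace VinbergAlgebra

variable {I : Type*} [PartialOrder I] [Fintype I] {A : I → I → Type*}
  [∀ i j, NormedAddCommGroup (A i j)] [∀ i j, NormedSpace ℝ (A i j)] (V : VinbergAlgebra I A)

/-- The map `u ↦ u u^*` on the `k`-th columns. -/
noncomputable def columnSq (k : I) (p : ℝ × ∀ j : {j // k < j}, A j k) : V.hermitian :=
  ⟨V.prod (V.column k p) (V.adj (V.column k p)), V.prod_adj_mem_hermitian _⟩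

open Classical in
/-- The exponent `χ` of the Riesz measure carried by the `u u^*`, `u` in the `k`-th column. -/
noncomputable def columnWeight (_V : VinbergAlgebra I A) (k : I) (α : ℝ) : I → ℝ := fun j =>
  if j = k then α else if k < j then (Module.finrank ℝ (A j k) : ℝ) / 2 else 0

lemma prod_rpow_columnWeight (k : I) [Fintype {j // k < j}] (α : ℝ) {T : BlockMatrix A}
    (hT : T ∈ V.TlPos) :
    ∏ j, (V.diag j (T j j) ^ 2) ^ (-V.columnWeight k α j) =
      (V.diag k (T k k) ^ 2) ^ (-α) *
        |(∏ j : {j // k < j}, V.diag j (T j j) ^ Module.finrank ℝ (A j k))⁻¹| := by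
  classical
  rw [Fintype.prod_eq_mul_prod_Ioi k, abs_of_pos, ← Finset.prod_inv_distrib]
  · congr 1
    · simp [columnWeight]
    · refine Finset.prod_congr rfl fun j _ => ?_
      have h := hT.2 j
      rw [columnWeight, if_neg j.2.ne', if_pos j.2, Real.rpow_neg (sq_nonneg _),
        ← Real.rpow_natCast, ← Real.rpow_natCast, ← Real.rpow_mul h.le]
      congr 2
      push_cast
      ring
  · exact inv_pos.2 (Finset.prod_pos fun j _ => pow_pos (hT.2 j) _)
  · intro i hi
    have h1 : i ≠ k := fun h => hi h.ge
    have h2 : ¬ k < i := fun h => hi h.le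
    simp [columnWeight, h1, h2]

lemma belowSq_smul (k : I) (c : ℝ) (v : ∀ j : {j // k < j}, A j k) :
    V.belowSq k (c • v) = c ^ 2 * V.belowSq k v := by
  simp only [VinbergData.belowSq, VinbergData.entrySq, Finset.mul_sum, Pi.smul_apply, map_smul,
    LinearMap.smul_apply, smul_eq_mul]
  exact Finset.sum_congr rfl fun j _ => by ring

lemma belowSq_pos (k : I) {v : ∀ j : {j // k < j}, A j k} (hv : v ≠ 0) : 0 < V.belowSq k v := by
  obtain ⟨j, hj⟩ := Function.ne_iff.1 hv
  refine Finset.sum_pos' (fun j _ => ?_) ⟨j, by simp, V.entrySq_pos _ _ hj⟩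
  by_cases h : v j = 0
  · rw [h]; simp [VinbergData.entrySq]
  · exact (V.entrySq_pos _ _ h).le

variable [∀ i j, FiniteDimensional ℝ (A i j)]

/-- The product as a continuous bilinear map. -/
noncomputable def prodL : BlockMatrix A →L[ℝ] BlockMatrix A →L[ℝ] BlockMatrix A :=
  V.prodₗ.toContinuousBilinearMap

/-- The involution as a continuous linear map. -/
noncomputable def adjL : BlockMatrix A →L[ℝ] BlockMatrix A := V.adjₗ.toContinuousLinearMap

lemma continuous_columnSq (k : I) : Continuous (V.columnSq k) := by
  refine Continuous.subtype_mk (f := fun p => V.prodL (V.column k p) (V.adjL (V.column k p))) ?_ _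
  have h := LinearMap.continuous_of_finiteDimensional (V.column k)
  fun_prop

lemma continuous_belowSq (k : I) : Continuous (V.belowSq k) := by
  have h : V.belowSq k = fun v => V.tr (V.columnSq k (0, v)).1 := by
    funext v
    simpa [columnSq] using (V.tr_column_prod_adj k (0, v)).symm
  rw [h]
  exact (LinearMap.continuous_of_finiteDimensional V.trₗ).comp
    (continuous_subtype_val.comp ((V.continuous_columnSq k).comp (by fun_prop)))

variable [∀ i j, ProperSpace (A i j)] [∀ i j, MeasurableSpace (A i j)]
  [∀ i j, BorelSpace (A i j)]

open Classical in
/-- The image under `u ↦ u u^*` of the measure on the `k`-th columns that is Lebesgue below the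
diagonal and has the density `r ^ (2 α - 1)` on the diagonal. -/
noncomputable def columnMeasure (k : I) (α : ℝ) : Measure V.hermitian :=
  ((radialMeasure α).prod Measure.addHaar).map (V.columnSq k)

instance (k : I) (α : ℝ) : SFinite (V.columnMeasure k α) := by
  unfold columnMeasure; infer_instance

lemma measurable_laplace_integrand (θ : BlockMatrix A) :
    Measurable fun Z : V.hermitian => ENNReal.ofReal (Real.exp (-V.tr (V.prod θ Z))) := by
  have h : Continuous fun Z : V.hermitian => V.tr (V.prod θ Z) :=
    LinearMap.continuous_of_finiteDimensional
      (V.trₗ.comp ((V.prodₗ θ).comp V.hermitian.subtype))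
  have h' := h.measurable
  fun_prop

lemma laplace_columnMeasure (k : I) {α : ℝ} (hα : 0 < α) :
    ∃ C : ENNReal, C ≠ 0 ∧ C ≠ ⊤ ∧ ∀ T ∈ V.TlPos,
      V.laplace (V.columnMeasure k α) (V.prod (V.adj T) T) =
        C * ENNReal.ofReal (∏ j, (V.diag j (T j j) ^ 2) ^ (-V.columnWeight k α j)) := by
  classical
  refine ⟨ENNReal.ofReal (Real.Gamma α / 2) *
    ∫⁻ v, ENNReal.ofReal (Real.exp (-V.belowSq k v)) ∂Measure.addHaar, ?_, ?_, fun T hT => ?_⟩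
  · refine mul_ne_zero ?_ ?_
    · simpa using Real.Gamma_pos_of_pos hα
    · have hm : Measurable fun v => ENNReal.ofReal (Real.exp (-V.belowSq k v)) :=
        (V.continuous_belowSq k).neg.rexp.measurable.ennreal_ofReal
      rw [Ne, lintegral_eq_zero_iff hm]
      intro h
      obtain ⟨v, hv⟩ := h.exists
      simp only [Pi.zero_apply, ENNReal.ofReal_eq_zero] at hv
      exact absurd hv (Real.exp_pos _).not_ge
  · exact ENNReal.mul_ne_top ENNReal.ofReal_ne_top (lintegral_exp_neg_lt_top _
      (V.continuous_belowSq k) (V.belowSq_smul k) fun v hv => V.belowSq_pos k hv).ne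
  · have hdet := V.det_belowMul k hT.1
    have hdet0 : LinearMap.det (V.belowMul k T) ≠ 0 := by
      rw [hdet]
      exact Finset.prod_ne_zero_iff.2 fun j _ => pow_ne_zero _ (hT.2 j).ne'
    rw [laplace, columnMeasure, lintegral_map (V.measurable_laplace_integrand _)
      (V.continuous_columnSq k).measurable, prod_rpow_columnWeight _ _ _ hT, ← hdet,
      ENNReal.ofReal_mul (Real.rpow_nonneg (sq_nonneg _) _), mul_comm,
      ← lintegral_radial_prod _ (V.continuous_belowSq k) hα (hT.2 k)
        (fun j : {j // k < j} => T j k) (V.belowMul k T) hdet0]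
    refine lintegral_congr fun p => ?_
    rw [columnSq, V.tr_dual_prod hT.1 (V.column_mem_Tl k p), V.prod_column k p hT.1,
      V.tr_column_prod_adj, mul_pow]

end VinbergAlgebra

lemma exists_initialSet_le {I : Type*} [PartialOrder I] [Finite I]
    (hI : ∀ i : I, ∃ j, i < j ∨ j < i) (l : I) : ∃ k ∈ initialSet I, k ≤ l := by
  obtain ⟨k, hkl, hk⟩ := (Set.toFinite {k : I | k ≤ l}).exists_le_minimal (a := l) le_rfl
  have hmin : ¬ ∃ j, j < k := fun ⟨j, hj⟩ => hk.not_lt (hj.le.trans hkl) hj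
  refine ⟨k, ⟨?_, hmin⟩, hkl⟩
  obtain ⟨j, hj | hj⟩ := hI k
  · exact ⟨j, hj⟩
  · exact absurd ⟨j, hj⟩ hmin

namespace VinbergAlgebra

variable {I : Type*} [PartialOrder I] [Fintype I] {A : I → I → Type*}
  [∀ i j, NormedAddCommGroup (A i j)] [∀ i j, NormedSpace ℝ (A i j)] (V : VinbergAlgebra I A)

/-- The additive monoid generated by the exponents of the column measures. -/
def columnMonoid : AddSubmonoid (I → ℝ) :=
  AddSubmonoid.closure {χ | ∃ k α, 0 < α ∧ χ = V.columnWeight k α}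

lemma columnWeight_mem (k : I) {α : ℝ} (hα : 0 < α) : V.columnWeight k α ∈ V.columnMonoid :=
  AddSubmonoid.subset_closure ⟨k, α, hα, rfl⟩

lemma mem_columnMonoid_of_mem_XiPsi {i : I} {ψ : I → Fin 2} (hψ : ∀ j, ¬ i ≤ j → ψ j = 0)
    {χ : I → ℝ} (hχ : χ ∈ V.XiPsi i ψ) : χ ∈ V.columnMonoid := by
  classical
  obtain ⟨h0, h1, h2⟩ := hχ
  have hle : ∀ k, ψ k = 1 → i ≤ k := fun k hk => by
    by_contra h
    rw [hψ k h] at hk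
    exact absurd hk (by decide)
  have hsum : χ = ∑ k with ψ k = 1, V.columnWeight k (χ k - V.nPsi ψ k / 2) := by
    funext j
    have hn : V.nPsi ψ j / 2 = ∑ k with ψ k = 1,
        if k < j then (Module.finrank ℝ (A j k) : ℝ) / 2 else 0 := by
      rw [nPsi, Finset.sum_div, Finset.sum_filter, Finset.sum_filter]
      refine Finset.sum_congr rfl fun k _ => ?_
      have : ψ k = 0 ∨ ψ k = 1 := by omega
      rcases this with h | h <;> simp [h]
    have hw : ∀ k, V.columnWeight k (χ k - V.nPsi ψ k / 2) j =
        (if k = j then χ k - V.nPsi ψ k / 2 else 0) +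
          if k < j then (Module.finrank ℝ (A j k) : ℝ) / 2 else 0 := by
      intro k
      unfold columnWeight
      by_cases h : k = j
      · subst h; simp
      · simp [h, Ne.symm h]
    rw [Finset.sum_apply]
    simp only [hw]
    rw [Finset.sum_add_distrib, ← hn, Finset.sum_ite_eq']
    have hj : ψ j = 0 ∨ ψ j = 1 := by omega
    rcases hj with hj | hj
    · by_cases hij : i ≤ j
      · simp [hj, h1 j hij hj]
      · rw [h0 j hij, hn, Finset.sum_eq_zero]
        · simp [hj]
        · intro k hk
          exact if_neg fun hkj => hij ((hle k (by simpa using hk)).trans hkj.le)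
    · simp [hj]
  rw [hsum]
  refine sum_mem fun k hk => V.columnWeight_mem k ?_
  have hk1 : ψ k = 1 := by simpa using hk
  linarith [h2 k (hle k hk1) hk1]

lemma mem_columnMonoid_of_mem_Xi {χ : I → ℝ} (hχ : χ ∈ V.Xi) : χ ∈ V.columnMonoid := by
  obtain ⟨c, hc, hc0, rfl⟩ := hχ
  refine sum_mem fun i _ => ?_
  by_cases hi : i ∈ initialSet I ∪ separatorSet I
  · obtain ⟨ψ, hψ, h⟩ := Set.mem_iUnion₂.1 (hc i hi)
    exact V.mem_columnMonoid_of_mem_XiPsi hψ.1 h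
  · rw [hc0 i hi]
    exact zero_mem _

lemma exists_eq_columnWeight_add {k : I} (hk : ¬ ∃ j, j < k) {χ : I → ℝ}
    (hχ : χ ∈ V.columnMonoid) (h : χ k ≠ 0) :
    ∃ α > 0, ∃ χ' ∈ V.columnMonoid, χ = V.columnWeight k α + χ' := by
  induction hχ using AddSubmonoid.closure_induction with
  | mem χ hχ =>
    obtain ⟨l, α, hα, rfl⟩ := hχ
    have hl : k = l := by
      by_contra hne
      have hlk : ¬ l < k := fun h' => hk ⟨l, h'⟩
      exact h (by simp [columnWeight, hne, hlk])
    subst hl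
    exact ⟨α, hα, 0, zero_mem _, (add_zero _).symm⟩
  | zero => exact absurd rfl h
  | add χ₁ χ₂ h₁ h₂ ih₁ ih₂ =>
    by_cases hz : χ₁ k = 0
    · obtain ⟨α, hα, χ', hχ', rfl⟩ := ih₂ (by simpa [hz] using h)
      exact ⟨α, hα, χ₁ + χ', add_mem h₁ hχ', by abel⟩
    · obtain ⟨α, hα, χ', hχ', rfl⟩ := ih₁ hz
      exact ⟨α, hα, χ' + χ₂, add_mem hχ' h₂, by abel⟩

section Polarization

/-- The projection `X ↦ (X + X^*) / 2` to the Hermitian matrices. -/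
noncomputable def hermPart : BlockMatrix A →ₗ[ℝ] V.hermitian :=
  ((1 / 2 : ℝ) • (LinearMap.id + V.adjₗ)).codRestrict V.hermitian fun X =>
    V.hermitian.smul_mem _ <| by
      change V.adj (X + V.adj X) = X + V.adj X
      rw [V.adj_add, V.adj_adj, add_comm]

lemma hermPart_coe (X : BlockMatrix A) :
    (V.hermPart X : BlockMatrix A) = (1 / 2 : ℝ) • (X + V.adj X) := rfl

lemma hermPart_self (Z : V.hermitian) : V.hermPart Z = Z := by
  apply Subtype.ext
  rw [hermPart_coe, V.mem_hermitian.1 Z.2, ← two_smul ℝ, smul_smul]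
  norm_num

lemma hermPart_adj (X : BlockMatrix A) : V.hermPart (V.adj X) = V.hermPart X := by
  apply Subtype.ext
  rw [hermPart_coe, hermPart_coe, V.adj_adj, add_comm]

lemma elem_eq_column {k j : I} (h : k ≤ j) (a : A j k) : ∃ p, V.elem j k a = V.column k p := by
  refine ⟨(V.diag k (V.elem j k a k k), fun l => V.elem j k a l k),
    BlockMatrix.column_ext k ?_ (fun l hl => ?_) (fun i l hil => ?_) fun i l hil => ?_⟩
  · rw [V.column_apply_self, LinearEquiv.symm_apply_apply]
  · rw [V.column_apply_of_lt k _ ⟨l, hl⟩]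
  · by_cases hl : l = k
    · subst hl
      exact V.elem_mem_Tl h a i l fun h' => hil ⟨rfl, h'⟩
    · exact V.elem_apply_ne_right hl _ _ _
  · by_cases hl : l = k
    · exact V.column_apply_not_le k _ (fun h' => hil ⟨hl, h'⟩) l
    · exact V.column_apply_ne k _ hl i

lemma sum_elem (X : BlockMatrix A) : X = ∑ i, ∑ j, V.elem i j (X i j) := by
  funext p q
  simp only [Finset.sum_apply]
  rw [Finset.sum_eq_single p, Finset.sum_eq_single q, V.elem_apply_same]
  · intro j _ hj
    exact V.elem_apply_ne_right hj.symm _ _ _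
  · simp
  · intro i _ hi
    exact Finset.sum_eq_zero fun j _ => V.elem_apply_ne_left hi.symm _ _ _
  · simp

/-- The `u u^*`, for `u` in the columns of the initial elements, span the Hermitian matrices. -/
lemma eq_zero_of_columnSq (hI : ∀ i : I, ∃ j, i < j ∨ j < i) (f : V.hermitian →ₗ[ℝ] ℝ)
    (hf : ∀ k ∈ initialSet I, ∀ p, f (V.columnSq k p) = 0) : f = 0 := by
  have hsq : ∀ k ∈ initialSet I, ∀ p,
      f (V.hermPart (V.prod (V.column k p) (V.adj (V.column k p)))) = 0 := fun k hk p => by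
    have h := hf k hk p
    rwa [← V.hermPart_self (V.columnSq k p)] at h
  have hpol : ∀ k ∈ initialSet I, ∀ p q,
      f (V.hermPart (V.prod (V.column k p) (V.adj (V.column k q)))) = 0 := by
    intro k hk p q
    have h := hsq k hk (p + q)
    have hs : V.hermPart (V.prod (V.column k q) (V.adj (V.column k p))) =
        V.hermPart (V.prod (V.column k p) (V.adj (V.column k q))) := by
      rw [← V.hermPart_adj, V.adj_prod, V.adj_adj]
    rw [map_add, V.adj_add, V.add_prod, V.prod_add, V.prod_add] at h
    simp only [map_add, hs, hsq k hk p, hsq k hk q] at h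
    linarith
  have hlow : ∀ j l, l ≤ j → ∀ a, f (V.hermPart (V.elem j l a)) = 0 := by
    intro j l hlj a
    obtain ⟨k, hk, hkl⟩ := exists_initialSet_le hI l
    obtain ⟨v, hv⟩ : ∃ v : A l k, v ≠ 0 := by
      rcases hkl.eq_or_lt with rfl | hlt
      · exact ⟨(V.diag k).symm 1, by simp⟩
      · have := Module.nontrivial_of_finrank_pos (V.finrank_pos l k hlt)
        exact exists_ne 0
    obtain ⟨p, hp⟩ := V.elem_eq_column (hkl.trans hlj) (V.mul j l k a v)
    obtain ⟨q, hq⟩ := V.elem_eq_column hkl v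
    have h := hpol k hk p q
    rw [← hp, ← hq, V.adj_elem, V.elem_prod_elem, V.mul_mul_star hlj hkl] at h
    have he : V.elem j l (V.entrySq l k v • a) = V.entrySq l k v • V.elem j l a := by
      simp [VinbergData.elem, Pi.single_smul]
    rw [he, map_smul, map_smul] at h
    exact (smul_eq_zero.1 h).resolve_left (V.entrySq_pos _ _ hv).ne'
  have hall : ∀ i j a, f (V.hermPart (V.elem i j a)) = 0 := by
    intro i j a
    by_cases h1 : j ≤ i
    · exact hlow i j h1 a
    by_cases h2 : i ≤ j
    · rw [← V.hermPart_adj, V.adj_elem]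
      exact hlow j i h2 _
    · have := V.subsingleton i j h2 h1
      rw [Subsingleton.elim a 0]
      simp [VinbergData.elem]
  ext Z
  rw [← V.hermPart_self Z, V.sum_elem Z]
  simp [map_sum, hall]

end Polarization

/-- The linear form `Z ↦ tr (η Z)` on the Hermitian matrices. -/
def trForm (η : BlockMatrix A) : V.hermitian →ₗ[ℝ] ℝ :=
  V.trₗ.comp ((V.prodₗ η).comp V.hermitian.subtype)

lemma trForm_apply (η : BlockMatrix A) (Z : V.hermitian) : V.trForm η Z = V.tr (V.prod η Z) := rfl

lemma trForm_self_pos {η : V.hermitian} (h : η ≠ 0) : 0 < V.trForm η η := by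
  have h1 := V.tr_self_pos η fun h' => h (Subtype.ext h')
  rwa [V.mem_hermitian.1 η.2] at h1

lemma exists_lowerTri_add_adj (H : V.hermitian) :
    ∃ T : V.lowerTri, (T : BlockMatrix A) + V.adj T = H := by
  classical
  have hH : ∀ i j, V.star j i (H.1 j i) = H.1 i j := fun i j => congrFun (congrFun H.2 i) j
  refine ⟨⟨fun i j => if j < i then H.1 i j else if i = j then (1 / 2 : ℝ) • H.1 i j else 0,
    fun i j hij => ?_⟩, ?_⟩
  · have h1 : ¬ j < i := fun h => hij h.le
    have h2 : i ≠ j := fun h => hij h.ge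
    simp [h1, h2]
  · funext i j
    simp only [Pi.add_apply, VinbergData.adj]
    by_cases h1 : j < i
    · simp [h1, h1.not_gt, h1.ne]
    by_cases h2 : i = j
    · subst h2
      simp only [lt_irrefl, if_false, if_true, map_smul, hH]
      rw [← add_smul]; norm_num
    by_cases h3 : i < j
    · simp [h1, h2, h3, hH]
    · have := V.subsingleton i j (fun h => h3 (lt_of_le_of_ne h h2))
        fun h => h1 (lt_of_le_of_ne h (Ne.symm h2))
      exact Subsingleton.elim _ _

variable [∀ i j, FiniteDimensional ℝ (A i j)]

lemma exists_trForm_eq (f : V.hermitian →ₗ[ℝ] ℝ) : ∃ η : V.hermitian, V.trForm η = f := by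
  let Φ : V.hermitian →ₗ[ℝ] Module.Dual ℝ V.hermitian :=
    { toFun := fun η => V.trForm η
      map_add' := fun η η' => by
        ext Z
        simp [trForm_apply, V.add_prod, V.tr_add]
      map_smul' := fun c η => by
        ext Z
        simp [trForm] }
  have hinj : Function.Injective Φ := by
    rw [← LinearMap.ker_eq_bot, LinearMap.ker_eq_bot']
    intro η hη
    by_contra h
    exact (V.trForm_self_pos h).ne' (LinearMap.congr_fun hη η)
  exact (LinearMap.injective_iff_surjective_of_finrank_eq_finrank
    Subspace.dual_finrank_eq.symm).1 hinj f

open Filter Topology in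
/-- The dual cone is a neighbourhood of the unit. -/
lemma eventually_mem_dualCone :
    ∀ᶠ θ : V.hermitian in 𝓝 ⟨V.one, V.one_mem_hermitian⟩, (θ : BlockMatrix A) ∈ V.dualCone := by
  let P : BlockMatrix A →L[ℝ] V.hermitian := V.hermPart.toContinuousLinearMap
  let ι : V.lowerTri →L[ℝ] BlockMatrix A := V.lowerTri.subtypeL
  let f : V.lowerTri → V.hermitian := fun T => P (V.prodL (V.adjL (ι T)) (ι T))
  let e : V.lowerTri := ⟨V.one, V.one_mem_TlPos.1⟩
  have hf : ∀ T : V.lowerTri, f T = ⟨V.prod (V.adj T) T, V.adj_prod_mem_hermitian T⟩ :=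
    fun T => V.hermPart_self ⟨V.prod (V.adj T) T, V.adj_prod_mem_hermitian T⟩
  have hd := P.hasStrictFDerivAt.comp e (V.prodL.hasStrictFDerivAt_of_bilinear
    ((V.adjL.comp ι).hasStrictFDerivAt (x := e)) (ι.hasStrictFDerivAt (x := e)))
  have := FiniteDimensional.complete ℝ V.lowerTri
  have := FiniteDimensional.complete ℝ V.hermitian
  have hmap : map f (𝓝 e) = 𝓝 (f e) := hd.map_nhds_eq_of_surj (by
    rw [LinearMap.range_eq_top]
    intro H
    obtain ⟨T, hT⟩ := V.exists_lowerTri_add_adj H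
    refine ⟨T, ?_⟩
    change V.hermPart (V.prod (V.adj V.one) T + V.prod (V.adj T) V.one) = H
    rw [V.adj_one, V.one_prod, V.prod_one, hT, V.hermPart_self])
  have hfe : f e = ⟨V.one, V.one_mem_hermitian⟩ := by
    rw [hf]
    apply Subtype.ext
    change V.prod (V.adj V.one) V.one = V.one
    rw [V.adj_one, V.one_prod]
  rw [← hfe, ← hmap, eventually_map]
  have hpos : ∀ i, ∀ᶠ T : V.lowerTri in 𝓝 e, 0 < V.diag i ((T : BlockMatrix A) i i) := by
    intro i
    have hc : Continuous fun T : V.lowerTri => V.diag i ((T : BlockMatrix A) i i) :=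
      (LinearMap.continuous_of_finiteDimensional (V.diag i).toLinearMap).comp
        ((continuous_apply_apply i i).comp continuous_subtype_val)
    exact hc.continuousAt.eventually (lt_mem_nhds (V.one_mem_TlPos.2 i))
  filter_upwards [eventually_all.2 hpos] with T hT
  exact ⟨T, ⟨T.2, hT⟩, by rw [hf]⟩

end VinbergAlgebra

namespace VinbergAlgebra

variable {I : Type*} [PartialOrder I] [Fintype I] {A : I → I → Type*}
  [∀ i j, NormedAddCommGroup (A i j)] [∀ i j, NormedSpace ℝ (A i j)] (V : VinbergAlgebra I A)

lemma one_mem_dualCone : V.one ∈ V.dualCone :=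
  ⟨V.one, V.one_mem_TlPos, by rw [V.adj_one, V.one_prod]⟩

lemma exists_dual_factor_elem (i : I) {y : ℝ} (hy : 0 < y) :
    ∃ T ∈ V.TlPos, V.one + V.elem i i ((V.diag i).symm (y ^ 2 - 1)) = V.prod (V.adj T) T ∧
      ∀ j, j ≠ i → V.diag j (T j j) = 1 := by
  have hsame : (V.one + V.elem i i ((V.diag i).symm (y - 1))) i i = (V.diag i).symm y := by
    rw [Pi.add_apply, Pi.add_apply, V.one_apply_self, V.elem_apply_same, ← map_add]
    simp
  have hne : ∀ j, j ≠ i → (V.one + V.elem i i ((V.diag i).symm (y - 1))) j j =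
      (V.diag j).symm 1 := by
    intro j hj
    rw [Pi.add_apply, Pi.add_apply, V.one_apply_self, V.elem_apply_ne_left hj, add_zero]
  refine ⟨V.one + V.elem i i ((V.diag i).symm (y - 1)), ⟨V.lowerTri.add_mem V.one_mem_TlPos.1
    (V.elem_mem_Tl le_rfl _), fun j => ?_⟩, ?_, fun j hj => by rw [hne j hj]; simp⟩
  · by_cases hj : j = i
    · subst hj; rw [hsame]; simpa using hy
    · rw [hne j hj]; simp
  · rw [V.adj_add, V.adj_one, V.adj_elem, V.star_diag, V.add_prod, V.one_prod, V.prod_add,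
      V.prod_one, V.elem_prod_elem, V.diag_mul, add_assoc]
    congr 1
    simp only [VinbergData.elem, ← Pi.single_add]
    congr 2
    apply (V.diag i).injective
    simp
    ring

variable [∀ i j, FiniteDimensional ℝ (A i j)] [∀ i j, MeasurableSpace (A i j)]

lemma isRieszMeasure_iff {χ : I → ℝ} {R : Measure V.hermitian} :
    V.IsRieszMeasure χ R ↔ ∀ T ∈ V.TlPos, V.laplace R (V.prod (V.adj T) T) =
      ENNReal.ofReal (∏ k, (V.diag k (T k k) ^ 2) ^ (-χ k)) := by
  constructor
  · intro h T hT
    rw [h _ ⟨T, hT, rfl⟩, V.genPower_dualInv χ hT]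
  · rintro h _ ⟨T, hT, rfl⟩
    rw [h T hT, V.genPower_dualInv χ hT]

lemma IsRieszMeasure.laplace_one {χ : I → ℝ} {R : Measure V.hermitian}
    (h : V.IsRieszMeasure χ R) : V.laplace R V.one = 1 := by
  have h1 := V.isRieszMeasure_iff.1 h V.one V.one_mem_TlPos
  rw [V.adj_one, V.one_prod] at h1
  simpa [V.one_apply_self] using h1

lemma IsRieszMeasure.ne_zero {χ : I → ℝ} {R : Measure V.hermitian}
    (h : V.IsRieszMeasure χ R) : R ≠ 0 := by
  rintro rfl
  simpa [laplace] using h.laplace_one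

variable [∀ i j, ProperSpace (A i j)] [∀ i j, BorelSpace (A i j)]

lemma laplace_conv (μ ν : Measure V.hermitian) [SFinite ν] (θ : BlockMatrix A) :
    V.laplace (μ ∗ ν) θ = V.laplace μ θ * V.laplace ν θ := by
  unfold laplace
  rw [Measure.lintegral_conv (V.measurable_laplace_integrand θ),
    ← lintegral_mul_const _ (V.measurable_laplace_integrand θ)]
  refine lintegral_congr fun X => ?_
  rw [← lintegral_const_mul _ (V.measurable_laplace_integrand θ)]
  refine lintegral_congr fun Y => ?_
  rw [← ENNReal.ofReal_mul (Real.exp_pos _).le, ← Real.exp_add, Submodule.coe_add, V.prod_add,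
    V.tr_add, neg_add]

lemma IsRieszMeasure.conv {χ χ' : I → ℝ} {R R' : Measure V.hermitian} [SFinite R']
    (h : V.IsRieszMeasure χ R) (h' : V.IsRieszMeasure χ' R') :
    V.IsRieszMeasure (χ + χ') (R ∗ R') := by
  rw [isRieszMeasure_iff] at *
  intro T hT
  rw [laplace_conv, h T hT, h' T hT, ← ENNReal.ofReal_mul
    (Finset.prod_nonneg fun k _ => Real.rpow_nonneg (sq_nonneg _) _), ← Finset.prod_mul_distrib]
  congr 1
  refine Finset.prod_congr rfl fun k _ => ?_
  rw [← Real.rpow_add (pow_pos (hT.2 k) 2), Pi.add_apply, neg_add]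

lemma exists_isRieszMeasure_columnWeight (k : I) {α : ℝ} (hα : 0 < α) :
    ∃ c : ENNReal, c ≠ 0 ∧ V.IsRieszMeasure (V.columnWeight k α) (c • V.columnMeasure k α) := by
  obtain ⟨C, h0, htop, h⟩ := V.laplace_columnMeasure k hα
  refine ⟨C⁻¹, ENNReal.inv_ne_zero.2 htop, V.isRieszMeasure_iff.2 fun T hT => ?_⟩
  have h1 := h T hT
  unfold laplace at h1 ⊢
  rw [lintegral_smul_measure, h1, smul_eq_mul, ← mul_assoc, ENNReal.inv_mul_cancel h0 htop,
    one_mul]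

lemma exists_isRieszMeasure {χ : I → ℝ} (hχ : χ ∈ V.columnMonoid) :
    ∃ R : Measure V.hermitian, SFinite R ∧ V.IsRieszMeasure χ R := by
  induction hχ using AddSubmonoid.closure_induction with
  | mem χ hχ =>
    obtain ⟨k, α, hα, rfl⟩ := hχ
    obtain ⟨c, -, hc⟩ := V.exists_isRieszMeasure_columnWeight k hα
    exact ⟨_, inferInstance, hc⟩
  | zero =>
    refine ⟨Measure.dirac 0, inferInstance, V.isRieszMeasure_iff.2 fun T hT => ?_⟩
    rw [laplace, lintegral_dirac' _ (V.measurable_laplace_integrand _), ZeroMemClass.coe_zero,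
      ← V.prodₗ_apply, map_zero, ← V.trₗ_apply, map_zero]
    simp
  | add χ₁ χ₂ h₁ h₂ ih₁ ih₂ =>
    obtain ⟨R₁, _, hR₁⟩ := ih₁
    obtain ⟨R₂, _, hR₂⟩ := ih₂
    exact ⟨R₁ ∗ R₂, inferInstance, hR₁.conv V hR₂⟩

/-- Equality in the convexity of the Laplace transform forces concentration on a hyperplane. -/
lemma measure_ne_eq_zero_of_laplace {ν : Measure V.hermitian} {θ η : BlockMatrix A} {c : ℝ}
    (hfin : V.laplace ν θ ≠ ⊤)
    (hadd : V.laplace ν (θ + η) = ENNReal.ofReal (Real.exp (-c)) * V.laplace ν θ)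
    (hsub : V.laplace ν (θ - η) = ENNReal.ofReal (Real.exp c) * V.laplace ν θ) :
    ν {Z | V.trForm η Z ≠ c} = 0 := by
  have hm := V.measurable_laplace_integrand
  have hmul : ∀ (b : ℝ) (ξ : BlockMatrix A), ENNReal.ofReal (Real.exp b) * V.laplace ν ξ =
      ∫⁻ Z, ENNReal.ofReal (Real.exp (b - V.tr (V.prod ξ Z))) ∂ν := by
    intro b ξ
    unfold laplace
    rw [← lintegral_const_mul _ (hm ξ)]
    refine lintegral_congr fun Z => ?_
    rw [← ENNReal.ofReal_mul (Real.exp_pos _).le, ← Real.exp_add, sub_eq_add_neg]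
  have h1 : ∫⁻ Z, ENNReal.ofReal (Real.exp (c - V.tr (V.prod (θ + η) Z))) ∂ν =
      V.laplace ν θ := by
    rw [← hmul, hadd, ← mul_assoc, ← ENNReal.ofReal_mul (Real.exp_pos _).le, ← Real.exp_add]
    simp
  have h2 : ∫⁻ Z, ENNReal.ofReal (Real.exp (-c - V.tr (V.prod (θ - η) Z))) ∂ν =
      V.laplace ν θ := by
    rw [← hmul, hsub, ← mul_assoc, ← ENNReal.ofReal_mul (Real.exp_pos _).le, ← Real.exp_add]
    simp
  have hm' : ∀ (b : ℝ) (ξ : BlockMatrix A), Measurable fun Z : V.hermitian =>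
      ENNReal.ofReal (Real.exp (b - V.tr (V.prod ξ Z))) := by
    intro b ξ
    have : Measurable fun Z : V.hermitian => V.tr (V.prod ξ Z) :=
      (LinearMap.continuous_of_finiteDimensional (V.trForm ξ)).measurable
    fun_prop
  have hexp : ∀ Z : V.hermitian, ENNReal.ofReal (Real.exp (c - V.tr (V.prod (θ + η) Z))) +
      ENNReal.ofReal (Real.exp (-c - V.tr (V.prod (θ - η) Z))) =
      ENNReal.ofReal (Real.exp (-V.tr (V.prod θ Z)) *
        (Real.exp (-(V.trForm η Z - c)) + Real.exp (V.trForm η Z - c))) := by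
    intro Z
    have hs : V.tr (V.prod (θ - η) Z) = V.tr (V.prod θ Z) - V.tr (V.prod η Z) := by
      simp [← V.prodₗ_apply, ← V.trₗ_apply]
    rw [← ENNReal.ofReal_add (by positivity) (by positivity), mul_add, ← Real.exp_add,
      ← Real.exp_add, hs, V.add_prod, V.tr_add, trForm_apply]
    congr 3 <;> ring_nf
  have hae := ae_eq_of_ae_le_of_lintegral_le (μ := ν)
    (f := fun Z : V.hermitian => 2 * ENNReal.ofReal (Real.exp (-V.tr (V.prod θ Z))))
    (g := fun Z => ENNReal.ofReal (Real.exp (c - V.tr (V.prod (θ + η) Z))) +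
      ENNReal.ofReal (Real.exp (-c - V.tr (V.prod (θ - η) Z)))) ?_ ?_ ?_ ?_
  · rw [← compl_mem_ae_iff]
    filter_upwards [hae] with Z hZ
    by_contra hne
    have hne' : V.trForm η Z ≠ c := by simpa using hne
    rw [hexp Z, ← ENNReal.ofReal_ofNat, ← ENNReal.ofReal_mul zero_le_two,
      ENNReal.ofReal_eq_ofReal_iff (by positivity) (by positivity)] at hZ
    have h3 := Real.add_one_lt_exp (sub_ne_zero.2 hne')
    have h4 := Real.add_one_lt_exp (neg_ne_zero.2 (sub_ne_zero.2 hne'))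
    nlinarith [Real.exp_pos (-V.tr (V.prod θ Z))]
  · refine Filter.Eventually.of_forall fun Z => ?_
    dsimp only
    rw [hexp Z, ← ENNReal.ofReal_ofNat, ← ENNReal.ofReal_mul zero_le_two]
    refine ENNReal.ofReal_le_ofReal ?_
    have h3 := Real.add_one_le_exp (V.trForm η Z - c)
    have h4 := Real.add_one_le_exp (-(V.trForm η Z - c))
    nlinarith [Real.exp_pos (-V.tr (V.prod θ Z))]
  · rw [lintegral_const_mul _ (hm θ)]
    exact ENNReal.mul_ne_top ENNReal.ofNat_ne_top hfin
  · exact ((hm' _ _).add (hm' _ _)).aemeasurable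
  · rw [lintegral_add_left (hm' _ _), h1, h2, lintegral_const_mul _ (hm θ), two_mul]
    rfl

lemma laplace_of_measure_ne_eq_zero {ν : Measure V.hermitian} {η : BlockMatrix A} {c : ℝ}
    (h : ν {Z | V.trForm η Z ≠ c} = 0) (s : ℝ) (θ : BlockMatrix A) :
    V.laplace ν (θ + s • η) = ENNReal.ofReal (Real.exp (-(s * c))) * V.laplace ν θ := by
  unfold laplace
  rw [← lintegral_const_mul _ (V.measurable_laplace_integrand θ)]
  refine lintegral_congr_ae ?_
  have h' : ∀ᵐ Z ∂ν, V.trForm η Z = c := h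
  filter_upwards [h'] with Z hZ
  have hs : V.tr (V.prod (s • η) Z) = s * c := by
    rw [← hZ]; simp [trForm, ← V.prodₗ_apply, ← V.trₗ_apply]
  rw [← ENNReal.ofReal_mul (Real.exp_pos _).le, ← Real.exp_add, V.add_prod, V.tr_add, hs]
  congr 2
  ring

open Filter Topology in
lemma IsRieszMeasure.measure_ne_eq_zero {χ : I → ℝ} {R R' : Measure V.hermitian}
    (h : V.IsRieszMeasure χ R) (h' : V.IsRieszMeasure χ R') {f : V.hermitian →ₗ[ℝ] ℝ} {c : ℝ}
    (hc : R {Z | f Z ≠ c} = 0) : R' {Z | f Z ≠ c} = 0 := by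
  obtain ⟨η, rfl⟩ := V.exists_trForm_eq f
  let e : V.hermitian := ⟨V.one, V.one_mem_hermitian⟩
  have hline : ∀ ζ : V.hermitian,
      ∀ᶠ s : ℝ in 𝓝[>] 0, (V.one + s • (ζ : BlockMatrix A)) ∈ V.dualCone := by
    intro ζ
    have ht : Tendsto (fun s : ℝ => e + s • ζ) (𝓝[>] 0) (𝓝 e) := by
      have hcont : Continuous fun s : ℝ => e + s • ζ := by fun_prop
      have := hcont.tendsto 0
      rw [zero_smul, add_zero] at this
      exact this.mono_left nhdsWithin_le_nhds
    exact ht.eventually V.eventually_mem_dualCone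
  obtain ⟨s, ⟨h1, h2⟩, hs⟩ :=
    (((hline η).and (hline (-η))).and self_mem_nhdsWithin).exists
  have hs0 : s ≠ 0 := (Set.mem_Ioi.1 hs).ne'
  have heq : ∀ θ ∈ V.dualCone, V.laplace R' θ = V.laplace R θ := fun θ hθ => by
    rw [h θ hθ, h' θ hθ]
  have hneg : V.one + s • ((-η : V.hermitian) : BlockMatrix A) =
      V.one + (-s) • (η : BlockMatrix A) := by
    simp
  have key := V.measure_ne_eq_zero_of_laplace (ν := R') (θ := V.one)
    (η := s • (η : BlockMatrix A)) (c := s * c) (by rw [h'.laplace_one]; simp) ?_ ?_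
  · convert key using 3
    simp [trForm, hs0]
  · rw [heq _ h1, heq _ V.one_mem_dualCone, V.laplace_of_measure_ne_eq_zero hc]
  · rw [hneg] at h2
    rw [sub_eq_add_neg, ← neg_smul, heq _ h2, heq _ V.one_mem_dualCone,
      V.laplace_of_measure_ne_eq_zero hc]
    congr 3
    ring

lemma exists_measure_ne_eq_zero_of_conv {μ ν : Measure V.hermitian} [SFinite μ] [SFinite ν]
    (hν : ν ≠ 0) (f : V.hermitian →ₗ[ℝ] ℝ) (c : ℝ) (h : (μ ∗ ν) {Z | f Z ≠ c} = 0) :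
    ∃ b, μ {Z | f Z ≠ b} = 0 := by
  have hf : Measurable f := (LinearMap.continuous_of_finiteDimensional f).measurable
  have h1 : ∀ᵐ Z ∂(ν ∗ μ), f Z = c := by rw [Measure.conv_comm]; exact h
  rw [Measure.conv, ae_map_iff (by fun_prop) (measurableSet_eq_fun hf measurable_const)] at h1
  have := ae_neBot.2 hν
  obtain ⟨Y, hY⟩ := (Measure.ae_ae_of_ae_prod h1).exists
  refine ⟨c - f Y, ?_⟩
  change ∀ᵐ Z ∂μ, f Z = c - f Y
  filter_upwards [hY] with Z hZ
  rw [← hZ, map_add]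
  ring

lemma columnSq_eq_zero_of_measure {k : I} {α : ℝ} {f : V.hermitian →ₗ[ℝ] ℝ} {b : ℝ}
    (h : V.columnMeasure k α {Z | f Z ≠ b} = 0) (p : ℝ × ∀ j : {j // k < j}, A j k) :
    f (V.columnSq k p) = 0 := by
  classical
  have hfc := LinearMap.continuous_of_finiteDimensional f
  have hc : Continuous fun p => f (V.columnSq k p) := hfc.comp (V.continuous_columnSq k)
  have h1 : ∀ᵐ Z ∂V.columnMeasure k α, f Z = b := h
  rw [columnMeasure, ae_map_iff (V.continuous_columnSq k).aemeasurable
    (measurableSet_eq_fun hfc.measurable measurable_const)] at h1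
  have h2 := ((restrict_Ioi_absolutelyContinuous α).prod (Measure.AbsolutelyContinuous.rfl
    (μ := (Measure.addHaar : Measure (∀ j : {j // k < j}, A j k))))).ae_le h1
  rw [← Measure.restrict_univ (μ := (Measure.addHaar : Measure (∀ j : {j // k < j}, A j k))),
    Measure.prod_restrict] at h2
  have h3 : Set.EqOn (fun p => f (V.columnSq k p)) (fun _ => b) (Set.Ioi 0 ×ˢ Set.univ) :=
    Measure.eqOn_open_of_ae_eq h2 (isOpen_Ioi.prod isOpen_univ) hc.continuousOn
      continuousOn_const
  have h4 : ∀ p : ℝ × ∀ j : {j // k < j}, A j k, 0 ≤ p.1 → f (V.columnSq k p) = b := by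
    intro p hp
    refine h3.closure hc continuous_const ?_
    rw [closure_prod_eq, closure_Ioi, closure_univ]
    exact ⟨hp, trivial⟩
  have hz : V.columnSq k 0 = 0 := by
    apply Subtype.ext
    simp [columnSq, ← V.prodₗ_apply]
  have hb : b = 0 := by rw [← h4 0 le_rfl, hz, map_zero]
  subst hb
  rcases le_total 0 p.1 with hp | hp
  · exact h4 p hp
  · have hneg : V.columnSq k (-p) = V.columnSq k p := by
      apply Subtype.ext
      have : V.adj (-V.column k p) = -V.adj (V.column k p) := V.adjₗ.map_neg _
      simp [columnSq, this, ← V.prodₗ_apply]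
    rw [← hneg]
    exact h4 (-p) (by simpa using hp)

lemma IsRieszMeasure.not_generatesNEF {χ : I → ℝ} {R : Measure V.hermitian}
    (h : V.IsRieszMeasure χ R) {i : I} (hi : χ i = 0) : ¬ V.GeneratesNEF R := by
  intro hN
  have hlap : ∀ y : ℝ, 0 < y →
      V.laplace R (V.one + V.elem i i ((V.diag i).symm (y ^ 2 - 1))) = 1 := by
    intro y hy
    obtain ⟨T, hT, hTe, hT1⟩ := V.exists_dual_factor_elem i hy
    rw [hTe, V.isRieszMeasure_iff.1 h T hT, Finset.prod_eq_one, ENNReal.ofReal_one]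
    intro j _
    by_cases hj : j = i
    · rw [hj, hi]; simp
    · rw [hT1 j hj]; simp
  let η : V.hermitian := ⟨V.elem i i ((V.diag i).symm (1 / 2)), by
    rw [V.mem_hermitian, V.adj_elem, V.star_diag]⟩
  have hη : η ≠ 0 := by
    intro h0
    have h1 := congrFun (congrFun (congrArg Subtype.val h0) i) i
    change V.elem i i ((V.diag i).symm (1 / 2)) i i = 0 at h1
    rw [V.elem_apply_same, map_eq_zero_iff _ (V.diag i).symm.injective] at h1
    norm_num at h1
  refine hN.1 (V.trForm η) 0 (fun h0 => ?_) (V.measure_ne_eq_zero_of_laplace (θ := V.one) ?_ ?_ ?_)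
  · exact (V.trForm_self_pos hη).ne' (by rw [h0]; rfl)
  · rw [h.laplace_one]; simp
  · have h1 := hlap (√(3 / 2)) (by positivity)
    rw [Real.sq_sqrt (by norm_num)] at h1
    rw [h.laplace_one]
    norm_num at h1 ⊢
    exact h1
  · have h1 := hlap (√(1 / 2)) (by positivity)
    rw [Real.sq_sqrt (by norm_num), show (1 / 2 - 1 : ℝ) = -(1 / 2) by norm_num, map_neg] at h1
    have h2 : V.elem i i (-(V.diag i).symm (1 / 2)) = -(η : BlockMatrix A) := by
      simp [η, VinbergData.elem, Pi.single_neg]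
    rw [h2, ← sub_eq_add_neg] at h1
    rw [h.laplace_one, h1]
    simp

lemma IsRieszMeasure.generatesNEF (hI : ∀ i : I, ∃ j, i < j ∨ j < i) {χ : I → ℝ}
    {R : Measure V.hermitian} (h : V.IsRieszMeasure χ R) (hχ : χ ∈ V.columnMonoid)
    (hχ0 : ∀ i ∈ initialSet I, χ i ≠ 0) : V.GeneratesNEF R := by
  refine ⟨fun f c hf hc => hf ?_, ⟨V.one, V.one_mem_hermitian⟩, ?_⟩
  · refine V.eq_zero_of_columnSq hI f fun k hk p => ?_
    obtain ⟨α, hα, χ', hχ', rfl⟩ := V.exists_eq_columnWeight_add hk.2 hχ (hχ0 k hk)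
    obtain ⟨a, ha, hR₁⟩ := V.exists_isRieszMeasure_columnWeight k hα
    obtain ⟨R₂, _, hR₂⟩ := V.exists_isRieszMeasure hχ'
    obtain ⟨b, hb⟩ := V.exists_measure_ne_eq_zero_of_conv hR₂.ne_zero f c
      (h.measure_ne_eq_zero V (hR₁.conv V hR₂) hc)
    refine V.columnSq_eq_zero_of_measure (α := α) (b := b) ?_ p
    rw [Measure.smul_apply, smul_eq_mul] at hb
    exact (mul_eq_zero.1 hb).resolve_left ha
  · rw [mem_interior_iff_mem_nhds]
    filter_upwards [V.eventually_mem_dualCone] with θ hθ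
    rw [h θ hθ]
    exact ENNReal.ofReal_lt_top

end VinbergAlgebra

theorem theorem4p1 {I : Type*} [PartialOrder I] [Fintype I] {A : I → I → Type*}
    [∀ i j, NormedAddCommGroup (A i j)] [∀ i j, NormedSpace ℝ (A i j)]
    [∀ i j, FiniteDimensional ℝ (A i j)]
    [∀ i j, MeasurableSpace (A i j)] [∀ i j, BorelSpace (A i j)]
    (V : VinbergAlgebra I A)
    (hI : ∀ i : I, ∃ j, i < j ∨ j < i)
    (χ : I → ℝ) (hχ : χ ∈ V.Xi) :
    (∃ R : Measure V.hermitian, V.IsRieszMeasure χ R) ∧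
      ∀ R : Measure V.hermitian, V.IsRieszMeasure χ R →
        (V.GeneratesNEF R ↔ ∀ i ∈ initialSet I ∪ separatorSet I, χ i ≠ 0) := by
  have : ∀ i j, ProperSpace (A i j) := fun i j => FiniteDimensional.proper ℝ (A i j)
  have hχ' := V.mem_columnMonoid_of_mem_Xi hχ
  refine ⟨?_, fun R hR => ⟨fun hN i _ hi => hR.not_generatesNEF V hi hN, fun h => ?_⟩⟩
  · obtain ⟨R, -, hR⟩ := V.exists_isRieszMeasure hχ'
    exact ⟨R, hR⟩
  · exact hR.generatesNEF V hI hχ' fun i hi => h i (Or.inl hi)
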